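/- **Language.** Let $\sigma$ be a signature with a countably infinite set of constants and countably many predicate symbols, each of positive arity. Formulas are built from atoms $P(t_1,\dots,t_n)$ and $s\equiv t$ (terms are constants or variables $v_0,v_1,\dots$) with $\bot,\land,\lor,\to,\square,\lozenge,\forall x,\exists x$; $\neg\phi$ is $\phi\to\bot$ and $\top$ is $\neg\bot$. A sentence is a formula without free variables. A formula $\phi(x)$ is one in which no variable other than $x$ is free, and $\phi(c)$ is the result of replacing the free occurrences of $x$ by the constant $c$. **Logics.** The theorems of $\mathsf{FOFS}$ are the sentences generated as follows, where $\phi,\psi$ are sentences except where $\phi(x)$ or $\psi(x)$ is written. Axioms: all substitution instances of theorems of intuitionistic propositional logic; $\square(\phi\land\psi)\leftrightarrow(\square\phi\land\square\psi)$; $\square\top$; $\lozenge(\phi\lor\psi)\leftrightarrow(\lozenge\phi\lor\lozenge\psi)$; $\neg\lozenge\bot$; $(\lozenge\phi\to\square\psi)\to\square(\phi\to\psi)$; $\lozenge(\phi\to\psi)\to(\square\phi\to\lozenge\psi)$; $\forall x\phi(x)\to\phi(c)$; $\phi(c)\to\exists x\phi(x)$; $\forall x(\phi(x)\to\psi)\to(\exists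 x\phi(x)\to\psi)$; $\forall x(\phi\to\psi(x))\to(\phi\to\forall x\psi(x))$; $c\equiv c$; and $c_1\equiv c_2\to(\phi(c_1)\to\phi(c_2))$ for $\phi(x)$ without $\square,\lozenge$. Rules: modus ponens; from $\phi(c)$ infer $\forall x\phi(x)$, provided $c$ does not occur in $\phi(x)$; from $\phi\to\psi$ infer $\square\phi\to\square\psi$ and $\lozenge\phi\to\lozenge\psi$. $\mathsf{FOFS4}$ is $\mathsf{FOFS}$ with the additional axioms $\square\phi\to\square\square\phi$ and $\lozenge\lozenge\phi\to\lozenge\phi$ for all sentences $\phi$; $\mathsf{FOFSD4}$ has moreover the axioms $\square\phi\to\lozenge\phi$. For a logic $L$ and a set $\Gamma$ of sentences, $\Gamma\vdash_L\phi$ means that $(\gamma_1\land\dots\land\gamma_k)\to\phi$ is a theorem of $L$ for some $k\ge 0$ and $\gamma_1,\dots,\gamma_k\in\Gamma$. **Semantics.** An $\mathsf{FOFS}$ frame consists of a set $W$, a partial order $\preccurlyeq$ and a relation $M$ on $W$ such that (FC1) if $wMv\preccurlyeq v'$ then $w\preccurlyeq w'Mv'$ for some $w'$, and (FC2) if $wMv$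 and $w\preccurlyeq w'$ then $v\preccurlyeq v'$ and $w'Mv'$ for some $v'$; of sets $D(w)$ $(w\in W)$ that grow along $\preccurlyeq$ and along $M$; and of equivalence relations $\approx_w$ on $D(w)$ that grow along $\preccurlyeq$. A model on it assigns to each constant an element lying in every $D(w)$, and to each $w$ and each $n$-ary $P$ a subset of $D(w)^n$ that is closed under $\approx_w$ and grows along $\preccurlyeq$. Truth at $w$ under an assignment $g$ of elements of $D(w)$ to the variables is defined as usual for atoms (with $\equiv$ read as $\approx_w$), $\land$, $\lor$, $\bot$, and by: $\phi\to\psi$ iff at every $w'\succcurlyeq w$ the truth of $\phi$ implies that of $\psi$; $\square\phi$ iff $\phi$ is true at every $v$ with $w\preccurlyeq w'Mv$ for some $w'$; $\lozenge\phi$ iff $\phi$ is true at some $v$ with $wMv$; $\forall x\phi$ iff for all $w'\succcurlyeq w$ and $a\in D(w')$, $\phi$ is true at $w'$ under $g[x:=a]$; $\exists x\phi$ iff for some $a\in D(w)$, $\phi$ is true at $w$ under $g[x:=a]$. For a class $\mathcal C$ of frames, $\Gamma\Vdash_{\mathcal C}\phi$ means that at every world of every model on a frame in $\mathcal C$ at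 which all members of $\Gamma$ are true, $\phi$ is true. **Theorem.** Let $\Gamma$ be a set of sentences and $\phi$ a sentence. 1. ($\mathsf{FOFS4}$ is complete for transitive frames.) If $\Gamma\Vdash_{\mathcal C}\phi$, where $\mathcal C$ is the class of $\mathsf{FOFS}$ frames with transitive $M$, then $\Gamma\vdash_{\mathsf{FOFS4}}\phi$. 2. ($\mathsf{FOFSD4}$ is sound and complete for serial transitive frames.) $\Gamma\Vdash_{\mathcal C'}\phi$ if and only if $\Gamma\vdash_{\mathsf{FOFSD4}}\phi$, where $\mathcal C'$ is the class of $\mathsf{FOFS}$ frames with serial and transitive $M$ (serial: every $w$ has some $v$ with $wMv$). -/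

import Mathlib

universe u v

namespace FOFS

/-! ### Intuitionistic propositional calculus -/

/-- Propositional formulas over countably many propositional letters. -/
inductive PForm : Type
  | atom (n : ℕ)
  | bot
  | and (A B : PForm)
  | or (A B : PForm)
  | imp (A B : PForm)

/-- Theorems of the intuitionistic propositional calculus `IPC`, in a standard Hilbert system. -/
inductive IPC : PForm → Prop
  | k (A B : PForm) : IPC (.imp A (.imp B A))
  | s (A B C : PForm) :
      IPC (.imp (.imp A (.imp B C)) (.imp (.imp A B) (.imp A C)))
  | and_left (A B : PForm) : IPC (.imp (.and A B) A)
  | and_right (A B : PForm) : IPC (.imp (.and A B) B)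
  | and_intro (A B : PForm) : IPC (.imp A (.imp B (.and A B)))
  | or_left (A B : PForm) : IPC (.imp A (.or A B))
  | or_right (A B : PForm) : IPC (.imp B (.or A B))
  | or_elim (A B C : PForm) :
      IPC (.imp (.imp A C) (.imp (.imp B C) (.imp (.or A B) C)))
  | exfalso (A : PForm) : IPC (.imp .bot A)
  | mp {A B : PForm} : IPC (.imp A B) → IPC A → IPC B

/-! ### The language -/

/-- A signature: a countably infinite set of constants, and countably many predicate symbols
with positive arities. -/
structure Signature where
  Const : Type
  Pred : Type
  arity : Pred → ℕ
  arity_pos : ∀ P, 0 < arity P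
  countable_const : Countable Const
  infinite_const : Infinite Const
  countable_pred : Countable Pred

/-- A term is a constant or one of the variables `v₀, v₁, v₂, …`. -/
inductive Term (σ : Signature) : Type
  | const (c : σ.Const)
  | var (x : ℕ)

/-- First-order modal formulas. -/
inductive Formula (σ : Signature) : Type
  | pred (P : σ.Pred) (t : Fin (σ.arity P) → Term σ)
  | eq (s t : Term σ)
  | bot
  | and (φ ψ : Formula σ)
  | or (φ ψ : Formula σ)
  | imp (φ ψ : Formula σ)
  | box (φ : Formula σ)
  | dia (φ : Formula σ)
  | all (x : ℕ) (φ : Formula σ)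
  | ex (x : ℕ) (φ : Formula σ)

namespace Term

variable {σ : Signature}

/-- The set of variables of a term. -/
def vars : Term σ → Set ℕ
  | .const _ => ∅
  | .var x => {x}

/-- The set of constants of a term. -/
def consts : Term σ → Set σ.Const
  | .const c => {c}
  | .var _ => ∅

/-- Replace the variable `x` by the constant `c`. -/
def subst (x : ℕ) (c : σ.Const) : Term σ → Term σ
  | .const d => .const d
  | .var y => if y = x then .const c else .var y

end Term

namespace Formula

variable {σ : Signature}

/-- `¬φ` abbreviates `φ → ⊥`. -/
def neg (φ : Formula σ) : Formula σ := .imp φ .bot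

/-- `⊤` abbreviates `¬⊥`. -/
def top : Formula σ := neg .bot

/-- `φ ↔ ψ` abbreviates `(φ → ψ) ∧ (ψ → φ)`. -/
def iff (φ ψ : Formula σ) : Formula σ := .and (.imp φ ψ) (.imp ψ φ)

/-- The set of free variables. -/
def freeVars : Formula σ → Set ℕ
  | .pred _ t => ⋃ i, (t i).vars
  | .eq s t => s.vars ∪ t.vars
  | .bot => ∅
  | .and φ ψ => φ.freeVars ∪ ψ.freeVars
  | .or φ ψ => φ.freeVars ∪ ψ.freeVars
  | .imp φ ψ => φ.freeVars ∪ ψ.freeVars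
  | .box φ => φ.freeVars
  | .dia φ => φ.freeVars
  | .all x φ => φ.freeVars \ {x}
  | .ex x φ => φ.freeVars \ {x}

/-- A sentence is a formula without free variables. -/
def IsSentence (φ : Formula σ) : Prop := φ.freeVars = ∅

/-- No variable other than `x` is free in `φ`. Such a `φ` is written `φ(x)`. -/
def FreeOnly (x : ℕ) (φ : Formula σ) : Prop := φ.freeVars ⊆ {x}

/-- The set of constants that occur in a formula. -/
def consts : Formula σ → Set σ.Const
  | .pred _ t => ⋃ i, (t i).consts
  | .eq s t => s.consts ∪ t.consts
  | .bot => ∅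
  | .and φ ψ => φ.consts ∪ ψ.consts
  | .or φ ψ => φ.consts ∪ ψ.consts
  | .imp φ ψ => φ.consts ∪ ψ.consts
  | .box φ => φ.consts
  | .dia φ => φ.consts
  | .all _ φ => φ.consts
  | .ex _ φ => φ.consts

/-- `φ(c)`: every free occurrence of the variable `x` is replaced by the constant `c`. -/
def subst (x : ℕ) (c : σ.Const) : Formula σ → Formula σ
  | .pred P t => .pred P (fun i => (t i).subst x c)
  | .eq s t => .eq (s.subst x c) (t.subst x c)
  | .bot => .bot
  | .and φ ψ => .and (φ.subst x c) (ψ.subst x c)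
  | .or φ ψ => .or (φ.subst x c) (ψ.subst x c)
  | .imp φ ψ => .imp (φ.subst x c) (ψ.subst x c)
  | .box φ => .box (φ.subst x c)
  | .dia φ => .dia (φ.subst x c)
  | .all y φ => if y = x then .all y φ else .all y (φ.subst x c)
  | .ex y φ => if y = x then .ex y φ else .ex y (φ.subst x c)

/-- `φ` contains neither `□` nor `◇`. -/
def ModalFree : Formula σ → Prop
  | .pred _ _ => True
  | .eq _ _ => True
  | .bot => True
  | .and φ ψ => φ.ModalFree ∧ ψ.ModalFree
  | .or φ ψ => φ.ModalFree ∧ ψ.ModalFree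
  | .imp φ ψ => φ.ModalFree ∧ ψ.ModalFree
  | .box _ => False
  | .dia _ => False
  | .all _ φ => φ.ModalFree
  | .ex _ φ => φ.ModalFree

/-- The conjunction of a finite list of formulas; the empty conjunction is `⊤`. -/
def conj : List (Formula σ) → Formula σ
  | [] => top
  | φ :: l => .and φ (conj l)

end Formula

/-- The substitution instance of a propositional formula under `s`. -/
def PForm.inst {σ : Signature} (s : ℕ → Formula σ) : PForm → Formula σ
  | .atom n => s n
  | .bot => .bot
  | .and A B => .and (A.inst s) (B.inst s)
  | .or A B => .or (A.inst s) (B.inst s)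
  | .imp A B => .imp (A.inst s) (B.inst s)

/-! ### The Hilbert systems -/

open Formula in
/-- `Provable Ax φ`: `φ` is a theorem of `FOFS ⊕ Ax`, the first-order Fischer Servi logic `FOFS`
extended by the members of `Ax` as further axioms. -/
inductive Provable {σ : Signature} (Ax : Set (Formula σ)) : Formula σ → Prop
  | extra {φ : Formula σ} (h : φ ∈ Ax) : Provable Ax φ
  | int {A : PForm} (hA : IPC A) (s : ℕ → Formula σ) (hs : ∀ n, (s n).IsSentence) :
      Provable Ax (A.inst s)
  | box_and {φ ψ : Formula σ} (hφ : φ.IsSentence) (hψ : ψ.IsSentence) :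
      Provable Ax (iff (.box (.and φ ψ)) (.and (.box φ) (.box ψ)))
  | box_top : Provable Ax (.box top)
  | dia_or {φ ψ : Formula σ} (hφ : φ.IsSentence) (hψ : ψ.IsSentence) :
      Provable Ax (iff (.dia (.or φ ψ)) (.or (.dia φ) (.dia ψ)))
  | dia_bot : Provable Ax (neg (.dia .bot))
  | fs1 {φ ψ : Formula σ} (hφ : φ.IsSentence) (hψ : ψ.IsSentence) :
      Provable Ax (.imp (.imp (.dia φ) (.box ψ)) (.box (.imp φ ψ)))
  | fs2 {φ ψ : Formula σ} (hφ : φ.IsSentence) (hψ : ψ.IsSentence) :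
      Provable Ax (.imp (.dia (.imp φ ψ)) (.imp (.box φ) (.dia ψ)))
  | univ {x : ℕ} {φ : Formula σ} (hφ : φ.FreeOnly x) (c : σ.Const) :
      Provable Ax (.imp (.all x φ) (φ.subst x c))
  | exist {x : ℕ} {φ : Formula σ} (hφ : φ.FreeOnly x) (c : σ.Const) :
      Provable Ax (.imp (φ.subst x c) (.ex x φ))
  | all_ant {x : ℕ} {φ ψ : Formula σ} (hφ : φ.FreeOnly x) (hψ : ψ.IsSentence) :
      Provable Ax (.imp (.all x (.imp φ ψ)) (.imp (.ex x φ) ψ))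
  | all_con {x : ℕ} {φ ψ : Formula σ} (hφ : φ.IsSentence) (hψ : ψ.FreeOnly x) :
      Provable Ax (.imp (.all x (.imp φ ψ)) (.imp φ (.all x ψ)))
  | id_refl (c : σ.Const) : Provable Ax (.eq (.const c) (.const c))
  | id_sub {x : ℕ} {φ : Formula σ} (hφ : φ.FreeOnly x) (hm : φ.ModalFree) (c₁ c₂ : σ.Const) :
      Provable Ax (.imp (.eq (.const c₁) (.const c₂)) (.imp (φ.subst x c₁) (φ.subst x c₂)))
  | mp {φ ψ : Formula σ} : Provable Ax (.imp φ ψ) → Provable Ax φ → Provable Ax ψ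
  /-- Generalization: the condition `c ∉ φ.consts` says that `φ` arises from the premise by
  replacing every occurrence of `c` by `x`, with no new `x` captured by a quantifier. -/
  | gen {x : ℕ} {φ : Formula σ} {c : σ.Const} (hφ : φ.FreeOnly x) (hc : c ∉ φ.consts) :
      Provable Ax (φ.subst x c) → Provable Ax (.all x φ)
  | reg_box {φ ψ : Formula σ} : Provable Ax (.imp φ ψ) → Provable Ax (.imp (.box φ) (.box ψ))
  | reg_dia {φ ψ : Formula σ} : Provable Ax (.imp φ ψ) → Provable Ax (.imp (.dia φ) (.dia ψ))

/-- `Γ ⊢ φ` in `FOFS ⊕ Ax`: some finite conjunction of members of `Γ` provably implies `φ`. -/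
def Derives {σ : Signature} (Ax Γ : Set (Formula σ)) (φ : Formula σ) : Prop :=
  ∃ l : List (Formula σ), (∀ γ ∈ l, γ ∈ Γ) ∧ Provable Ax (.imp (Formula.conj l) φ)

/-- The axioms `□φ → ◇φ`, for all sentences `φ`. -/
def axD (σ : Signature) : Set (Formula σ) :=
  {χ | ∃ φ : Formula σ, φ.IsSentence ∧ χ = .imp (.box φ) (.dia φ)}

/-- The axioms `□φ → □□φ`, for all sentences `φ`. -/
def ax4Box (σ : Signature) : Set (Formula σ) :=
  {χ | ∃ φ : Formula σ, φ.IsSentence ∧ χ = .imp (.box φ) (.box (.box φ))}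

/-- The axioms `◇◇φ → ◇φ`, for all sentences `φ`. -/
def ax4Dia (σ : Signature) : Set (Formula σ) :=
  {χ | ∃ φ : Formula σ, φ.IsSentence ∧ χ = .imp (.dia (.dia φ)) (.dia φ)}

/-- The axioms that `FOFS4` adds to `FOFS`. -/
def axFOFS4 (σ : Signature) : Set (Formula σ) := ax4Box σ ∪ ax4Dia σ

/-- The axioms that `FOFSD4` adds to `FOFS`. -/
def axFOFSD4 (σ : Signature) : Set (Formula σ) := axD σ ∪ (ax4Box σ ∪ ax4Dia σ)

/-! ### Birelational semantics -/

/-- A Fischer Servi frame: a partial order `≤` and a relation `M` that are compatible. -/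
structure FSFrame where
  World : Type u
  order : PartialOrder World
  M : World → World → Prop
  fc1 : ∀ w v v', M w v → v ≤ v' → ∃ w', w ≤ w' ∧ M w' v'
  fc2 : ∀ w w' v, M w v → w ≤ w' → ∃ v', v ≤ v' ∧ M w' v'

attribute [instance] FSFrame.order

/-- An `FOFS` frame: a Fischer Servi frame with a domain system. The domains are subsets of an
ambient type `Obj`; `E w` is an equivalence relation on `D w`, given as a set of pairs. -/
structure Frame extends FSFrame.{u} where
  Obj : Type v
  D : World → Set Obj
  D_le : ∀ w w', w ≤ w' → D w ⊆ D w'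
  D_M : ∀ w w', M w w' → D w ⊆ D w'
  E : World → Obj → Obj → Prop
  E_mem : ∀ w a b, E w a b → a ∈ D w ∧ b ∈ D w
  E_refl : ∀ w, ∀ a ∈ D w, E w a a
  E_symm : ∀ w a b, E w a b → E w b a
  E_trans : ∀ w a b c, E w a b → E w b c → E w a c
  E_le : ∀ w w' a b, w ≤ w' → E w a b → E w' a b

/-- An interpretation of the signature `σ` on an `FOFS` frame. -/
structure Interp (σ : Signature) (F : Frame.{u, v}) where
  const : σ.Const → F.Obj
  const_mem : ∀ c w, const c ∈ F.D w
  pred : F.World → (P : σ.Pred) → Set (Fin (σ.arity P) → F.Obj)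
  pred_mem : ∀ w P, ∀ a ∈ pred w P, ∀ i, a i ∈ F.D w
  pred_le : ∀ w w' P, w ≤ w' → pred w P ⊆ pred w' P
  pred_E : ∀ w P a b, (∀ i, F.E w (a i) (b i)) → a ∈ pred w P → b ∈ pred w P

namespace Interp

variable {σ : Signature} {F : Frame.{u, v}}

/-- The denotation of a term under a variable assignment. -/
def den (I : Interp σ F) (g : ℕ → F.Obj) : Term σ → F.Obj
  | .const c => I.const c
  | .var x => g x

/-- Truth of a formula at the world `w` under the variable assignment `g`. -/
def Sat (I : Interp σ F) : Formula σ → F.World → (ℕ → F.Obj) → Prop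
  | .pred P t, w, g => (fun i => I.den g (t i)) ∈ I.pred w P
  | .eq s t, w, g => F.E w (I.den g s) (I.den g t)
  | .bot, _, _ => False
  | .and φ ψ, w, g => I.Sat φ w g ∧ I.Sat ψ w g
  | .or φ ψ, w, g => I.Sat φ w g ∨ I.Sat ψ w g
  | .imp φ ψ, w, g => ∀ w', w ≤ w' → I.Sat φ w' g → I.Sat ψ w' g
  | .box φ, w, g => ∀ w' v, w ≤ w' → F.M w' v → I.Sat φ v g
  | .dia φ, w, g => ∃ v, F.M w v ∧ I.Sat φ v g
  | .all x φ, w, g => ∀ w', w ≤ w' → ∀ a ∈ F.D w', I.Sat φ w' (Function.update g x a)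
  | .ex x φ, w, g => ∃ a ∈ F.D w, I.Sat φ w (Function.update g x a)

/-- Truth at `w`: truth under every assignment `g` with values in the domain of `w`. -/
def TrueAt (I : Interp σ F) (w : F.World) (φ : Formula σ) : Prop :=
  ∀ g : ℕ → F.Obj, (∀ x, g x ∈ F.D w) → I.Sat φ w g

end Interp

/-- `Γ ⊩ φ` over the frame class `C`: at every world of every model on a frame in `C`, if all
members of `Γ` are true, then `φ` is true. -/
def Entails {σ : Signature} (C : Set Frame.{u, v}) (Γ : Set (Formula σ)) (φ : Formula σ) : Prop :=
  ∀ F ∈ C, ∀ (I : Interp σ F) (w : F.World), (∀ γ ∈ Γ, I.TrueAt w γ) → I.TrueAt w φ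

/-- The `FOFS` frames whose modal relation is transitive. -/
def transitiveFrames : Set Frame.{u, v} :=
  {F | ∀ w₁ w₂ w₃, F.M w₁ w₂ → F.M w₂ w₃ → F.M w₁ w₃}

/-- The `FOFS` frames whose modal relation is serial. -/
def serialFrames : Set Frame.{u, v} := {F | ∀ w, ∃ v, F.M w v}

end FOFS

/-! Soundness is an induction over theorems. Generalization makes a constant denote an element that
need not lie in every domain, so the induction ranges over assignments to the constants with values
merely in the domain of the world at hand (`PredInterp.sat_of_provable`).

Completeness comes from a canonical model whose worlds are paths instead of single theories. A path
is a finite nonempty sequence of prime theories with witnesses, consecutive ones joined by `Link`: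
□φ in the earlier theory puts φ in the later one, and φ in the later one, if it belongs to the
earlier language, puts ◇φ in the earlier one. Paths of equal length are ordered layer by layer, and
a path accesses its proper prolongations. So M is transitive by construction, and FC1 holds by
truncation. For FC2 the remaining layers are rebuilt over an enlarged initial part
(`exists_append_extension`). The axioms 4 link layers that are not adjacent (`IsPath.link`), as the
truth lemma `sat_canonicalInterp` needs; the axiom D supplies one more layer, hence seriality.

The difficulty lies in the truth lemma for →, □ and ∀. There the last theory has to grow, and the ◇
half of `Link` forces the earlier ones to grow too. `exists_maximal_extension` works backwards: if
the last theory is to imply no member of a directed set B, the theory before it is made to imply no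
□θ, for the θ that would lead to B, and so on down to the first layer. All these theories are chosen
maximal. If α then entered the later theory without ◇α being in the earlier one, maximality would
give ◇α → □θ there, the axiom `fs1` would give □(α → θ), and θ would enter the later theory: a
contradiction (`exists_layer_avoiding`).

Each depth of a path has its own constants, released level by level, so that fresh witnesses never
run out and earlier layers never use the constants of later ones. When theories in different
languages meet, foreign constants are quantified away (`Ded.exists_exClosure`,
`Ded.exists_allClosure`). As the signature is fixed, room for new constants is made by renaming the
given ones into a part of the constants. -/

namespace FOFS

/-! ### Syntax -/

namespace Term

variable {σ : Signature}

/-- Rename the constants along `f`. -/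
def map (f : σ.Const → σ.Const) : Term σ → Term σ
  | .const c => .const (f c)
  | .var x => .var x

/-- Replace each variable in the domain of the partial assignment `ρ` by its value. -/
def close (ρ : ℕ → Option σ.Const) : Term σ → Term σ
  | .const c => .const c
  | .var x => (ρ x).elim (.var x) .const

open Classical in
/-- Replace the constant `c` by the variable `x`. -/
noncomputable def abstr (c : σ.Const) (x : ℕ) : Term σ → Term σ
  | .const d => if d = c then .var x else .const d
  | .var y => .var y

theorem finite_vars (t : Term σ) : t.vars.Finite := by
  cases t <;> simp [vars]

theorem finite_consts (t : Term σ) : t.consts.Finite := by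
  cases t <;> simp [consts]

theorem close_none (t : Term σ) : t.close (fun _ => none) = t := by
  cases t <;> simp [close]

theorem close_congr {t : Term σ} {ρ ρ' : ℕ → Option σ.Const}
    (h : ∀ x ∈ t.vars, ρ x = ρ' x) : t.close ρ = t.close ρ' := by
  cases t <;> simp_all [close, vars]

theorem subst_close (t : Term σ) {ρ : ℕ → Option σ.Const} {x : ℕ} (hx : ρ x = none)
    (c : σ.Const) : (t.close ρ).subst x c = t.close (Function.update ρ x (some c)) := by
  cases t with
  | const d => rfl
  | var y =>
    by_cases hy : y = x
    · subst hy; simp [close, hx, subst]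
    · cases h : ρ y <;> simp [close, h, subst, hy]

theorem vars_close (t : Term σ) (ρ : ℕ → Option σ.Const) :
    (t.close ρ).vars = {x ∈ t.vars | ρ x = none} := by
  cases t with
  | const d => simp [close, vars]
  | var y => cases h : ρ y <;> ext z <;> simp [close, h, vars] <;> aesop

theorem consts_close (t : Term σ) (ρ : ℕ → Option σ.Const) :
    (t.close ρ).consts ⊆ t.consts ∪ {c | ∃ x, ρ x = some c} := by
  cases t with
  | const d => simp [close, consts]
  | var y =>
    cases h : ρ y
    · simp [close, h, consts]
    · simpa [close, h, consts] using ⟨y, h⟩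

theorem vars_map (f : σ.Const → σ.Const) (t : Term σ) : (t.map f).vars = t.vars := by
  cases t <;> rfl

theorem consts_map (f : σ.Const → σ.Const) (t : Term σ) :
    (t.map f).consts = f '' t.consts := by
  cases t <;> simp [map, consts]

theorem map_congr {f f' : σ.Const → σ.Const} {t : Term σ} (h : ∀ c ∈ t.consts, f c = f' c) :
    t.map f = t.map f' := by
  cases t <;> simp_all [map, consts]

theorem map_map_of_leftInverse {f f' : σ.Const → σ.Const} (h : ∀ c, f' (f c) = c) (t : Term σ) :
    (t.map f).map f' = t := by
  cases t <;> simp [map, h]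

theorem map_subst (f : σ.Const → σ.Const) (x : ℕ) (c : σ.Const) (t : Term σ) :
    (t.subst x c).map f = (t.map f).subst x (f c) := by
  cases t with
  | const d => rfl
  | var y => by_cases hy : y = x <;> simp [subst, map, hy]

theorem subst_abstr (c : σ.Const) {x : ℕ} {t : Term σ} (hx : x ∉ t.vars) :
    (t.abstr c x).subst x c = t := by
  cases t with
  | const d => by_cases hd : d = c <;> simp [abstr, subst, hd]
  | var y =>
    have : y ≠ x := fun h => hx (by simp [vars, h])
    simp [abstr, subst, this]

theorem vars_abstr (c : σ.Const) (x : ℕ) (t : Term σ) :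
    (t.abstr c x).vars ⊆ insert x t.vars := by
  cases t with
  | const d => by_cases hd : d = c <;> simp [abstr, vars, hd]
  | var y => simp [abstr, vars]

theorem consts_abstr (c : σ.Const) (x : ℕ) (t : Term σ) :
    (t.abstr c x).consts ⊆ t.consts \ {c} := by
  cases t with
  | const d => by_cases hd : d = c <;> simp [abstr, consts, hd]
  | var y => simp [abstr, consts]

end Term

namespace Formula

variable {σ : Signature}

/-- Rename the constants along `f`. -/
def map (f : σ.Const → σ.Const) : Formula σ → Formula σ
  | .pred P t => .pred P (fun i => (t i).map f)
  | .eq s t => .eq (s.map f) (t.map f)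
  | .bot => .bot
  | .and φ ψ => .and (φ.map f) (ψ.map f)
  | .or φ ψ => .or (φ.map f) (ψ.map f)
  | .imp φ ψ => .imp (φ.map f) (ψ.map f)
  | .box φ => .box (φ.map f)
  | .dia φ => .dia (φ.map f)
  | .all y φ => .all y (φ.map f)
  | .ex y φ => .ex y (φ.map f)

/-- Replace the free occurrences of each variable in the domain of the partial assignment `ρ`
by its value. -/
def close (ρ : ℕ → Option σ.Const) : Formula σ → Formula σ
  | .pred P t => .pred P (fun i => (t i).close ρ)
  | .eq s t => .eq (s.close ρ) (t.close ρ)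
  | .bot => .bot
  | .and φ ψ => .and (φ.close ρ) (ψ.close ρ)
  | .or φ ψ => .or (φ.close ρ) (ψ.close ρ)
  | .imp φ ψ => .imp (φ.close ρ) (ψ.close ρ)
  | .box φ => .box (φ.close ρ)
  | .dia φ => .dia (φ.close ρ)
  | .all y φ => .all y (φ.close (Function.update ρ y none))
  | .ex y φ => .ex y (φ.close (Function.update ρ y none))

/-- Replace the constant `c` by the variable `x`. -/
noncomputable def abstr (c : σ.Const) (x : ℕ) : Formula σ → Formula σ
  | .pred P t => .pred P (fun i => (t i).abstr c x)
  | .eq s t => .eq (s.abstr c x) (t.abstr c x)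
  | .bot => .bot
  | .and φ ψ => .and (φ.abstr c x) (ψ.abstr c x)
  | .or φ ψ => .or (φ.abstr c x) (ψ.abstr c x)
  | .imp φ ψ => .imp (φ.abstr c x) (ψ.abstr c x)
  | .box φ => .box (φ.abstr c x)
  | .dia φ => .dia (φ.abstr c x)
  | .all y φ => .all y (φ.abstr c x)
  | .ex y φ => .ex y (φ.abstr c x)

/-- The variables that occur in a formula, free or bound or next to a quantifier. -/
def allVars : Formula σ → Set ℕ
  | .pred _ t => ⋃ i, (t i).vars
  | .eq s t => s.vars ∪ t.vars
  | .bot => ∅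
  | .and φ ψ => φ.allVars ∪ ψ.allVars
  | .or φ ψ => φ.allVars ∪ ψ.allVars
  | .imp φ ψ => φ.allVars ∪ ψ.allVars
  | .box φ => φ.allVars
  | .dia φ => φ.allVars
  | .all x φ => insert x φ.allVars
  | .ex x φ => insert x φ.allVars

theorem finite_allVars (φ : Formula σ) : φ.allVars.Finite := by
  induction φ <;> simp_all [allVars, Term.finite_vars, Set.finite_iUnion]

theorem finite_consts (φ : Formula σ) : φ.consts.Finite := by
  induction φ <;> simp_all [consts, Term.finite_consts, Set.finite_iUnion]

theorem exists_not_mem_allVars (φ : Formula σ) : ∃ x, x ∉ φ.allVars :=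
  φ.finite_allVars.infinite_compl.nonempty

/-! #### Sentences -/

@[simp] theorem isSentence_bot : (bot : Formula σ).IsSentence := rfl

@[simp] theorem isSentence_and {φ ψ : Formula σ} :
    (φ.and ψ).IsSentence ↔ φ.IsSentence ∧ ψ.IsSentence := Set.union_empty_iff

@[simp] theorem isSentence_or {φ ψ : Formula σ} :
    (φ.or ψ).IsSentence ↔ φ.IsSentence ∧ ψ.IsSentence := Set.union_empty_iff

@[simp] theorem isSentence_imp {φ ψ : Formula σ} :
    (φ.imp ψ).IsSentence ↔ φ.IsSentence ∧ ψ.IsSentence := Set.union_empty_iff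

@[simp] theorem isSentence_box {φ : Formula σ} : φ.box.IsSentence ↔ φ.IsSentence := Iff.rfl

@[simp] theorem isSentence_dia {φ : Formula σ} : φ.dia.IsSentence ↔ φ.IsSentence := Iff.rfl

@[simp] theorem isSentence_all {x : ℕ} {φ : Formula σ} :
    (φ.all x).IsSentence ↔ φ.FreeOnly x := Set.sdiff_eq_empty

@[simp] theorem isSentence_ex {x : ℕ} {φ : Formula σ} :
    (φ.ex x).IsSentence ↔ φ.FreeOnly x := Set.sdiff_eq_empty

@[simp] theorem isSentence_top : (top : Formula σ).IsSentence := by simp [top, neg]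

theorem isSentence_conj {l : List (Formula σ)} (h : ∀ φ ∈ l, φ.IsSentence) :
    (conj l).IsSentence := by
  induction l with
  | nil => simp [conj]
  | cons a l ih => simp_all [conj]

theorem IsSentence.freeOnly {φ : Formula σ} (h : φ.IsSentence) (x : ℕ) : φ.FreeOnly x := by
  rw [FreeOnly, h]; exact Set.empty_subset _

/-! #### Simultaneous substitution -/

theorem close_none (φ : Formula σ) : φ.close (fun _ => none) = φ := by
  induction φ <;> simp_all [close, Term.close_none]

theorem close_congr {φ : Formula σ} {ρ ρ' : ℕ → Option σ.Const}
    (h : ∀ x ∈ φ.freeVars, ρ x = ρ' x) : φ.close ρ = φ.close ρ' := by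
  induction φ generalizing ρ ρ' with
  | pred P t =>
    simp only [close, pred.injEq, heq_eq_eq, true_and]
    exact funext fun i => Term.close_congr fun x hx => h x (Set.mem_iUnion.2 ⟨i, hx⟩)
  | eq s t =>
    simp only [close, eq.injEq]
    exact ⟨Term.close_congr fun x hx => h x (.inl hx), Term.close_congr fun x hx => h x (.inr hx)⟩
  | bot => rfl
  | and φ ψ ih₁ ih₂ | or φ ψ ih₁ ih₂ | imp φ ψ ih₁ ih₂ =>
    simp only [close]
    rw [ih₁ fun x hx => h x (.inl hx), ih₂ fun x hx => h x (.inr hx)]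
  | box φ ih | dia φ ih => simp only [close]; rw [ih h]
  | all y φ ih | ex y φ ih =>
    simp only [close]
    rw [ih (ρ' := Function.update ρ' y none)]
    intro x hx
    by_cases hxy : x = y
    · subst hxy; simp
    · simpa [hxy] using h x ⟨hx, hxy⟩

/-- Only constants are substituted, so no capture can occur. This identity drives the quantifier
cases of the truth lemma: instantiating the variable left open by a quantifier amounts to updating
the assignment. -/
theorem subst_close (φ : Formula σ) {ρ : ℕ → Option σ.Const} {x : ℕ} (hx : ρ x = none)
    (c : σ.Const) : (φ.close ρ).subst x c = φ.close (Function.update ρ x (some c)) := by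
  induction φ generalizing ρ with
  | all y φ ih | ex y φ ih =>
    by_cases hy : y = x
    · subst hy; simp [close, subst]
    · simp only [close, subst, hy, if_false]
      rw [ih (by simp [Function.update_apply, hx]), Function.update_comm hy]
  | _ => simp_all [close, subst, Term.subst_close]

theorem subst_eq_close (φ : Formula σ) (x : ℕ) (c : σ.Const) :
    φ.subst x c = φ.close (Function.update (fun _ => none) x (some c)) := by
  rw [← subst_close φ rfl, close_none]

theorem freeVars_close (φ : Formula σ) (ρ : ℕ → Option σ.Const) :
    (φ.close ρ).freeVars = {x ∈ φ.freeVars | ρ x = none} := by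
  induction φ generalizing ρ with
  | all y φ ih | ex y φ ih =>
    ext x
    by_cases hx : x = y <;> simp [close, freeVars, ih, hx]
  | _ => ext x; simp_all [close, freeVars, Term.vars_close, or_and_right]

theorem consts_close (φ : Formula σ) (ρ : ℕ → Option σ.Const) :
    (φ.close ρ).consts ⊆ φ.consts ∪ {c | ∃ x, ρ x = some c} := by
  induction φ generalizing ρ with
  | pred P t =>
    refine Set.iUnion_subset fun i => (Term.consts_close _ _).trans ?_
    exact Set.union_subset_union_left _ (Set.subset_iUnion (fun i => (t i).consts) i)
  | eq s t =>
    refine Set.union_subset ((Term.consts_close _ _).trans ?_) ((Term.consts_close _ _).trans ?_)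
    · exact Set.union_subset_union_left _ Set.subset_union_left
    · exact Set.union_subset_union_left _ Set.subset_union_right
  | bot => exact Set.empty_subset _
  | and φ ψ ih₁ ih₂ | or φ ψ ih₁ ih₂ | imp φ ψ ih₁ ih₂ =>
    refine Set.union_subset ((ih₁ _).trans ?_) ((ih₂ _).trans ?_)
    · exact Set.union_subset_union_left _ Set.subset_union_left
    · exact Set.union_subset_union_left _ Set.subset_union_right
  | box φ ih | dia φ ih => exact ih ρ
  | all y φ ih | ex y φ ih =>
    refine (ih _).trans (Set.union_subset_union_right _ ?_)
    rintro c ⟨x, hx⟩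
    by_cases hxy : x = y
    · subst hxy; simp at hx
    · exact ⟨x, by simpa [hxy] using hx⟩

theorem freeVars_subst (φ : Formula σ) (x : ℕ) (c : σ.Const) :
    (φ.subst x c).freeVars = φ.freeVars \ {x} := by
  rw [subst_eq_close, freeVars_close]
  ext y
  by_cases hy : y = x <;> simp [hy]

theorem FreeOnly.isSentence_subst {φ : Formula σ} {x : ℕ} (h : φ.FreeOnly x) (c : σ.Const) :
    (φ.subst x c).IsSentence := by
  rw [IsSentence, freeVars_subst]; exact Set.sdiff_eq_empty.2 h

theorem consts_subst (φ : Formula σ) (x : ℕ) (c : σ.Const) :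
    (φ.subst x c).consts ⊆ insert c φ.consts := by
  rw [subst_eq_close]
  refine (consts_close _ _).trans ?_
  rintro d (hd | ⟨y, hy⟩)
  · exact .inr hd
  · by_cases hyx : y = x
    · subst hyx; simp at hy; exact .inl hy.symm
    · simp [hyx] at hy

theorem subst_of_isSentence {φ : Formula σ} (h : φ.IsSentence) (x : ℕ) (c : σ.Const) :
    φ.subst x c = φ := by
  rw [subst_eq_close]
  conv_rhs => rw [← close_none φ]
  exact close_congr fun y hy => by rw [h] at hy; exact hy.elim

/-! #### Renaming constants -/

theorem freeVars_map (f : σ.Const → σ.Const) (φ : Formula σ) :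
    (φ.map f).freeVars = φ.freeVars := by
  induction φ <;> simp_all [map, freeVars, Term.vars_map]

@[simp] theorem isSentence_map {f : σ.Const → σ.Const} {φ : Formula σ} :
    (φ.map f).IsSentence ↔ φ.IsSentence := by
  simp [IsSentence, freeVars_map]

@[simp] theorem freeOnly_map {f : σ.Const → σ.Const} {φ : Formula σ} {x : ℕ} :
    (φ.map f).FreeOnly x ↔ φ.FreeOnly x := by
  simp [FreeOnly, freeVars_map]

theorem consts_map (f : σ.Const → σ.Const) (φ : Formula σ) :
    (φ.map f).consts = f '' φ.consts := by
  induction φ <;> simp_all [map, consts, Term.consts_map, Set.image_union, Set.image_iUnion]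

theorem map_congr {f f' : σ.Const → σ.Const} {φ : Formula σ} (h : ∀ c ∈ φ.consts, f c = f' c) :
    φ.map f = φ.map f' := by
  induction φ with
  | pred P t =>
    simp only [map, pred.injEq, heq_eq_eq, true_and]
    exact funext fun i => Term.map_congr fun x hx => h x (Set.mem_iUnion.2 ⟨i, hx⟩)
  | eq s t =>
    simp only [map, eq.injEq]
    exact ⟨Term.map_congr fun x hx => h x (.inl hx), Term.map_congr fun x hx => h x (.inr hx)⟩
  | bot => rfl
  | and φ ψ ih₁ ih₂ | or φ ψ ih₁ ih₂ | imp φ ψ ih₁ ih₂ =>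
    simp only [map]
    rw [ih₁ fun x hx => h x (.inl hx), ih₂ fun x hx => h x (.inr hx)]
  | box φ ih | dia φ ih | all y φ ih | ex y φ ih => simp only [map]; rw [ih h]

theorem map_map_of_leftInverse {f f' : σ.Const → σ.Const} (h : ∀ c, f' (f c) = c)
    (φ : Formula σ) : (φ.map f).map f' = φ := by
  induction φ <;> simp_all [map, Term.map_map_of_leftInverse]

theorem map_subst (f : σ.Const → σ.Const) (x : ℕ) (c : σ.Const) (φ : Formula σ) :
    (φ.subst x c).map f = (φ.map f).subst x (f c) := by
  induction φ with
  | all y φ ih | ex y φ ih => by_cases hy : y = x <;> simp [subst, map, hy, ih]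
  | _ => simp_all [subst, map, Term.map_subst]

theorem modalFree_map {f : σ.Const → σ.Const} {φ : Formula σ} :
    (φ.map f).ModalFree ↔ φ.ModalFree := by
  induction φ <;> simp_all [map, ModalFree]

theorem map_inst (f : σ.Const → σ.Const) (s : ℕ → Formula σ) (A : PForm) :
    (A.inst s).map f = A.inst (fun n => (s n).map f) := by
  induction A <;> simp_all [PForm.inst, map]

/-! #### Abstracting a constant -/

/-- Freshness has to cover bound variables too: a quantifier over `x` would capture the variable put
in place of `c`. -/
theorem subst_abstr (c : σ.Const) {x : ℕ} {φ : Formula σ} (hx : x ∉ φ.allVars) :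
    (φ.abstr c x).subst x c = φ := by
  induction φ with
  | all y φ ih | ex y φ ih =>
    simp only [allVars, Set.mem_insert_iff, not_or] at hx
    simp [abstr, subst, Ne.symm hx.1, ih hx.2]
  | _ => simp_all [abstr, subst, allVars, Term.subst_abstr]

theorem freeVars_abstr (c : σ.Const) (x : ℕ) (φ : Formula σ) :
    (φ.abstr c x).freeVars ⊆ insert x φ.freeVars := by
  induction φ with
  | pred P t =>
    refine Set.iUnion_subset fun i => (Term.vars_abstr _ _ _).trans ?_
    exact Set.insert_subset_insert (Set.subset_iUnion (fun i => (t i).vars) i)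
  | eq s t =>
    refine Set.union_subset ((Term.vars_abstr _ _ _).trans ?_) ((Term.vars_abstr _ _ _).trans ?_)
    · exact Set.insert_subset_insert Set.subset_union_left
    · exact Set.insert_subset_insert Set.subset_union_right
  | bot => exact Set.empty_subset _
  | and φ ψ ih₁ ih₂ | or φ ψ ih₁ ih₂ | imp φ ψ ih₁ ih₂ =>
    refine Set.union_subset (ih₁.trans ?_) (ih₂.trans ?_)
    · exact Set.insert_subset_insert Set.subset_union_left
    · exact Set.insert_subset_insert Set.subset_union_right
  | box φ ih | dia φ ih => exact ih
  | all y φ ih | ex y φ ih =>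
    rintro z ⟨hz, hzy⟩
    rcases ih hz with h | h
    · exact .inl h
    · exact .inr ⟨h, hzy⟩

theorem consts_abstr (c : σ.Const) (x : ℕ) (φ : Formula σ) :
    (φ.abstr c x).consts ⊆ φ.consts \ {c} := by
  induction φ with
  | pred P t =>
    refine Set.iUnion_subset fun i => (Term.consts_abstr _ _ _).trans ?_
    exact Set.sdiff_subset_sdiff_left (Set.subset_iUnion (fun i => (t i).consts) i)
  | eq s t =>
    refine Set.union_subset ((Term.consts_abstr _ _ _).trans ?_)
      ((Term.consts_abstr _ _ _).trans ?_)
    · exact Set.sdiff_subset_sdiff_left Set.subset_union_left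
    · exact Set.sdiff_subset_sdiff_left Set.subset_union_right
  | bot => exact Set.empty_subset _
  | and φ ψ ih₁ ih₂ | or φ ψ ih₁ ih₂ | imp φ ψ ih₁ ih₂ =>
    refine Set.union_subset (ih₁.trans ?_) (ih₂.trans ?_)
    · exact Set.sdiff_subset_sdiff_left Set.subset_union_left
    · exact Set.sdiff_subset_sdiff_left Set.subset_union_right
  | box φ ih | dia φ ih | all y φ ih | ex y φ ih => exact ih

/-! #### Countability -/

/-- The formulas of nesting depth less than `n`. -/
def ofDepth (σ : Signature) : ℕ → Set (Formula σ)
  | 0 => ∅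
  | n + 1 =>
    Set.range (fun p : Σ P : σ.Pred, (Fin (σ.arity P) → Term σ) => pred p.1 p.2) ∪
    Set.range (fun p : Term σ × Term σ => eq p.1 p.2) ∪ {bot} ∪
    Set.image2 and (ofDepth σ n) (ofDepth σ n) ∪ Set.image2 or (ofDepth σ n) (ofDepth σ n) ∪
    Set.image2 imp (ofDepth σ n) (ofDepth σ n) ∪ box '' ofDepth σ n ∪ dia '' ofDepth σ n ∪
    Set.image2 all Set.univ (ofDepth σ n) ∪ Set.image2 ex Set.univ (ofDepth σ n)

instance : Countable (Term σ) := by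
  have := σ.countable_const
  refine Function.Injective.countable (β := σ.Const ⊕ ℕ)
    (f := fun t => match t with | .const c => .inl c | .var x => .inr x) ?_
  intro s t h
  cases s <;> cases t <;> simp_all

theorem countable_ofDepth (n : ℕ) : (ofDepth σ n).Countable := by
  have := σ.countable_pred
  induction n with
  | zero => exact Set.countable_empty
  | succ n ih =>
    simp only [ofDepth, Set.countable_union]
    refine ⟨⟨⟨⟨⟨⟨⟨⟨⟨?_, ?_⟩, ?_⟩, ?_⟩, ?_⟩, ?_⟩, ?_⟩, ?_⟩, ?_⟩, ?_⟩
    · exact Set.countable_range _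
    · exact Set.countable_range _
    · exact Set.countable_singleton _
    · exact ih.image2 ih _
    · exact ih.image2 ih _
    · exact ih.image2 ih _
    · exact ih.image _
    · exact ih.image _
    · exact Set.countable_univ.image2 ih _
    · exact Set.countable_univ.image2 ih _

theorem ofDepth_mono : Monotone (ofDepth σ) := by
  refine monotone_nat_of_le_succ fun n => ?_
  induction n with
  | zero => exact Set.empty_subset _
  | succ n ih =>
    rw [ofDepth, ofDepth]
    gcongr

theorem exists_mem_ofDepth (φ : Formula σ) : ∃ n, φ ∈ ofDepth σ n := by
  induction φ with
  | pred P t => exact ⟨1, by simp [ofDepth]⟩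
  | eq s t => exact ⟨1, by simp [ofDepth]⟩
  | bot => exact ⟨1, by simp [ofDepth]⟩
  | and φ ψ ih₁ ih₂ | or φ ψ ih₁ ih₂ | imp φ ψ ih₁ ih₂ =>
    obtain ⟨m, hm⟩ := ih₁
    obtain ⟨n, hn⟩ := ih₂
    refine ⟨max m n + 1, ?_⟩
    have h₁ := ofDepth_mono (le_max_left m n) hm
    have h₂ := ofDepth_mono (le_max_right m n) hn
    simp [ofDepth, h₁, h₂]
  | box φ ih | dia φ ih | all y φ ih | ex y φ ih =>
    obtain ⟨n, hn⟩ := ih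
    exact ⟨n + 1, by simp [ofDepth, hn]⟩

/-- Needed to decide all sentences one after the other when prime theories are built. Each depth is
countable over the previous one. -/
instance : Countable (Formula σ) := by
  rw [← Set.countable_univ_iff]
  refine (Set.countable_iUnion fun n => countable_ofDepth (σ := σ) n).mono fun φ _ => ?_
  exact Set.mem_iUnion.2 φ.exists_mem_ofDepth

end Formula

end FOFS

namespace FOFS

variable {σ : Signature} {Ax : Set (Formula σ)}

/-! ### Derivability from hypotheses -/

open Formula

/-- Renaming constants preserves provability, if it preserves the extra axioms. -/
theorem Provable.map (hAx : ∀ f, ∀ φ ∈ Ax, φ.map f ∈ Ax) {φ : Formula σ} (h : Provable Ax φ)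
    (f : σ.Const → σ.Const) : Provable Ax (φ.map f) := by
  classical
  induction h generalizing f with
  | extra h => exact .extra (hAx f _ h)
  | int hA s hs => rw [map_inst]; exact .int hA _ fun n => isSentence_map.2 (hs n)
  | box_and hφ hψ => exact .box_and (isSentence_map.2 hφ) (isSentence_map.2 hψ)
  | box_top => exact .box_top
  | dia_or hφ hψ => exact .dia_or (isSentence_map.2 hφ) (isSentence_map.2 hψ)
  | dia_bot => exact .dia_bot
  | fs1 hφ hψ => exact .fs1 (isSentence_map.2 hφ) (isSentence_map.2 hψ)
  | fs2 hφ hψ => exact .fs2 (isSentence_map.2 hφ) (isSentence_map.2 hψ)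
  | univ hφ c =>
    simp only [Formula.map, map_subst]
    exact .univ (freeOnly_map.2 hφ) _
  | exist hφ c =>
    simp only [Formula.map, map_subst]
    exact .exist (freeOnly_map.2 hφ) _
  | all_ant hφ hψ => exact .all_ant (freeOnly_map.2 hφ) (isSentence_map.2 hψ)
  | all_con hφ hψ => exact .all_con (isSentence_map.2 hφ) (freeOnly_map.2 hψ)
  | id_refl c => exact .id_refl _
  | id_sub hφ hm c₁ c₂ =>
    simp only [Formula.map, map_subst]
    exact .id_sub (freeOnly_map.2 hφ) (modalFree_map.2 hm) _ _
  | mp _ _ ih₁ ih₂ => exact .mp (ih₁ f) (ih₂ f)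
  | @gen x φ c hφ hc _ ih =>
    -- `f` need not be injective, so `f c` may occur in the renamed formula. The premise is
    -- therefore renamed with `c` sent to a fresh `d`, which leaves the image of `φ` unchanged
    -- because `c` does not occur in it.
    have := σ.infinite_const
    obtain ⟨d, hd⟩ := (φ.map f).finite_consts.infinite_compl.nonempty
    have hmap : φ.map (Function.update f c d) = φ.map f :=
      Formula.map_congr fun e he => Function.update_of_ne (by rintro rfl; exact hc he) _ _
    have := ih (Function.update f c d)
    rw [map_subst, hmap, Function.update_self] at this
    exact .gen (freeOnly_map.2 hφ) hd this
  | reg_box _ ih => exact .reg_box (ih f)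
  | reg_dia _ ih => exact .reg_dia (ih f)

/-- `Ded Ax X φ`: `φ` follows from sentences in `X` and theorems by modus ponens. -/
inductive Ded (Ax X : Set (Formula σ)) : Formula σ → Prop
  | hyp {φ : Formula σ} (h : φ ∈ X) (hs : φ.IsSentence) : Ded Ax X φ
  | thm {φ : Formula σ} (h : Provable Ax φ) (hs : φ.IsSentence) : Ded Ax X φ
  | mp {φ ψ : Formula σ} : Ded Ax X (.imp φ ψ) → Ded Ax X φ → Ded Ax X ψ

/-! ### Propositional reasoning under hypotheses -/

/-- An assignment of three formulas to the propositional letters. -/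
def inst₃ (a b c : Formula σ) : ℕ → Formula σ
  | 0 => a
  | 1 => b
  | _ => c

theorem isSentence_inst₃ {a b c : Formula σ} (ha : a.IsSentence) (hb : b.IsSentence)
    (hc : c.IsSentence) : ∀ n, (inst₃ a b c n).IsSentence
  | 0 => ha
  | 1 => hb
  | _ + 2 => hc

theorem Provable.inst₃ {A : PForm} (hA : IPC A) {a b c : Formula σ} (ha : a.IsSentence)
    (hb : b.IsSentence) (hc : c.IsSentence) : Provable Ax (A.inst (inst₃ a b c)) :=
  .int hA _ (isSentence_inst₃ ha hb hc)

namespace Ded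

variable {X Y : Set (Formula σ)} {φ ψ χ : Formula σ}

theorem isSentence (h : Ded Ax X φ) : φ.IsSentence := by
  induction h with
  | hyp _ hs => exact hs
  | thm _ hs => exact hs
  | mp _ _ ih _ => exact (isSentence_imp.1 ih).2

theorem cut (h : Ded Ax Y φ) (hY : ∀ ψ ∈ Y, ψ.IsSentence → Ded Ax X ψ) : Ded Ax X φ := by
  induction h with
  | hyp h hs => exact hY _ h hs
  | thm h hs => exact .thm h hs
  | mp _ _ ih₁ ih₂ => exact .mp ih₁ ih₂

theorem mono (h : Ded Ax X φ) (hXY : X ⊆ Y) : Ded Ax Y φ :=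
  h.cut fun _ hψ hs => .hyp (hXY hψ) hs

/-- The deduction theorem has no side condition on constants or modalities, because generalization
and the modal rules act only inside `Provable`, and modus ponens is the only rule under hypotheses.
-/
theorem imp_intro (h : Ded Ax (insert φ X) ψ) (hφ : φ.IsSentence) : Ded Ax X (.imp φ ψ) := by
  have k {ψ : Formula σ} (hψ : Ded Ax X ψ) : Ded Ax X (.imp φ ψ) := by
    have := hψ.isSentence
    refine .mp (.thm (φ := .imp ψ (.imp φ ψ)) ?_ (by simp [*])) hψ
    exact Provable.inst₃ (.k (.atom 0) (.atom 1)) this hφ hφ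
  have s {ψ χ : Formula σ} (h₁ : Ded Ax X (.imp φ (.imp ψ χ))) (h₂ : Ded Ax X (.imp φ ψ)) :
      Ded Ax X (.imp φ χ) := by
    have := h₁.isSentence
    simp only [isSentence_imp] at this
    refine .mp (.mp (.thm (φ := .imp (.imp φ (.imp ψ χ)) (.imp (.imp φ ψ) (.imp φ χ))) ?_
      (by simp [*])) h₁) h₂
    exact Provable.inst₃ (.s (.atom 0) (.atom 1) (.atom 2)) this.1 this.2.1 this.2.2
  induction h with
  | hyp h hs =>
    rcases Set.mem_insert_iff.1 h with h | h
    · subst h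
      rename_i φ
      have h₁ : Ded Ax X (.imp φ (.imp (.imp φ φ) φ)) :=
        .thm (Provable.inst₃ (.k (.atom 0) (.imp (.atom 0) (.atom 0))) hφ hφ hφ) (by simp [hφ])
      have h₂ : Ded Ax X (.imp φ (.imp φ φ)) :=
        .thm (Provable.inst₃ (.k (.atom 0) (.atom 0)) hφ hφ hφ) (by simp [hφ])
      exact s h₁ h₂
    · exact k (.hyp h hs)
  | thm h hs => exact k (.thm h hs)
  | mp _ _ ih₁ ih₂ => exact s ih₁ ih₂

theorem hyp_insert (hφ : φ.IsSentence) : Ded Ax (insert φ X) φ := .hyp (.inl rfl) hφ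

theorem weaken (h : Ded Ax X φ) : Ded Ax (insert ψ X) φ := h.mono (Set.subset_insert _ _)

theorem imp_elim (h : Ded Ax X (.imp φ ψ)) : Ded Ax (insert φ X) ψ :=
  .mp h.weaken (hyp_insert (isSentence_imp.1 h.isSentence).1)

theorem cut_insert (h : Ded Ax (insert φ X) ψ) (hφ : Ded Ax X φ) : Ded Ax X ψ :=
  .mp (h.imp_intro hφ.isSentence) hφ

theorem and_left (h : Ded Ax X (.and φ ψ)) : Ded Ax X φ := by
  have := isSentence_and.1 h.isSentence
  refine .mp (.thm (φ := .imp (.and φ ψ) φ) ?_ (by simp [*])) h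
  exact Provable.inst₃ (.and_left (.atom 0) (.atom 1)) this.1 this.2 this.2

theorem and_right (h : Ded Ax X (.and φ ψ)) : Ded Ax X ψ := by
  have := isSentence_and.1 h.isSentence
  refine .mp (.thm (φ := .imp (.and φ ψ) ψ) ?_ (by simp [*])) h
  exact Provable.inst₃ (.and_right (.atom 0) (.atom 1)) this.1 this.2 this.2

theorem and_intro (h₁ : Ded Ax X φ) (h₂ : Ded Ax X ψ) : Ded Ax X (.and φ ψ) := by
  have hφ := h₁.isSentence
  have hψ := h₂.isSentence
  refine .mp (.mp (.thm (φ := .imp φ (.imp ψ (.and φ ψ))) ?_ (by simp [*])) h₁) h₂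
  exact Provable.inst₃ (.and_intro (.atom 0) (.atom 1)) hφ hψ hψ

theorem or_left (h : Ded Ax X φ) (hψ : ψ.IsSentence) : Ded Ax X (.or φ ψ) := by
  have hφ := h.isSentence
  refine .mp (.thm (φ := .imp φ (.or φ ψ)) ?_ (by simp [*])) h
  exact Provable.inst₃ (.or_left (.atom 0) (.atom 1)) hφ hψ hψ

theorem or_right (h : Ded Ax X ψ) (hφ : φ.IsSentence) : Ded Ax X (.or φ ψ) := by
  have hψ := h.isSentence
  refine .mp (.thm (φ := .imp ψ (.or φ ψ)) ?_ (by simp [*])) h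
  exact Provable.inst₃ (.or_right (.atom 0) (.atom 1)) hφ hψ hψ

theorem or_elim (h : Ded Ax X (.or φ ψ)) (h₁ : Ded Ax (insert φ X) χ)
    (h₂ : Ded Ax (insert ψ X) χ) : Ded Ax X χ := by
  have := isSentence_or.1 h.isSentence
  have hχ := h₁.isSentence
  refine .mp (.mp (.mp (.thm (φ := .imp (.imp φ χ) (.imp (.imp ψ χ) (.imp (.or φ ψ) χ))) ?_
    (by simp [*])) (h₁.imp_intro this.1)) (h₂.imp_intro this.2)) h
  exact Provable.inst₃ (.or_elim (.atom 0) (.atom 1) (.atom 2)) this.1 this.2 hχ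

theorem exfalso (h : Ded Ax X .bot) (hφ : φ.IsSentence) : Ded Ax X φ :=
  .mp (.thm (φ := .imp .bot φ) (Provable.inst₃ (.exfalso (.atom 0)) hφ hφ hφ) (by simp [hφ])) h

theorem top : Ded Ax X Formula.top := imp_intro (hyp_insert rfl) rfl

theorem compact (h : Ded Ax X φ) :
    ∃ l : List (Formula σ), (∀ ψ ∈ l, ψ ∈ X ∧ ψ.IsSentence) ∧ Ded Ax {ψ | ψ ∈ l} φ := by
  induction h with
  | @hyp φ h hs => exact ⟨[φ], by simp [h, hs], .hyp (by simp) hs⟩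
  | thm h hs => exact ⟨[], by simp, .thm h hs⟩
  | mp _ _ ih₁ ih₂ =>
    obtain ⟨l₁, h₁, d₁⟩ := ih₁
    obtain ⟨l₂, h₂, d₂⟩ := ih₂
    refine ⟨l₁ ++ l₂, fun ψ hψ => ?_, .mp (d₁.mono ?_) (d₂.mono ?_)⟩
    · rcases List.mem_append.1 hψ with h | h
      · exact h₁ ψ h
      · exact h₂ ψ h
    · intro ψ hψ; exact List.mem_append.2 (.inl hψ)
    · intro ψ hψ; exact List.mem_append.2 (.inr hψ)

theorem provable (h : Ded Ax ∅ φ) : Provable Ax φ := by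
  induction h with
  | hyp h _ => exact h.elim
  | thm h _ => exact h
  | mp _ _ ih₁ ih₂ => exact .mp ih₁ ih₂

theorem of_mem_conj {l : List (Formula σ)} (h : Ded Ax X (conj l)) (hφ : φ ∈ l) : Ded Ax X φ := by
  induction l with
  | nil => simp at hφ
  | cons a l ih =>
    rcases List.mem_cons.1 hφ with rfl | hφ
    · exact h.and_left
    · exact ih h.and_right hφ

theorem conj_intro {l : List (Formula σ)} (h : ∀ φ ∈ l, Ded Ax X φ) : Ded Ax X (conj l) := by
  induction l with
  | nil => exact top
  | cons a l ih => exact and_intro (h a (by simp)) (ih fun φ hφ => h φ (by simp [hφ]))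

/-- Compactness, with a single hypothesis. -/
theorem exists_conj (h : Ded Ax X φ) :
    ∃ l : List (Formula σ), (∀ ψ ∈ l, ψ ∈ X ∧ ψ.IsSentence) ∧ Ded Ax {conj l} φ := by
  obtain ⟨l, hl, d⟩ := h.compact
  refine ⟨l, hl, d.cut fun ψ hψ _ => of_mem_conj (l := l) (.hyp rfl ?_) hψ⟩
  exact isSentence_conj fun ψ hψ => (hl ψ hψ).2

theorem derives (h : Ded Ax X φ) : Derives Ax X φ := by
  obtain ⟨l, hl, d⟩ := h.exists_conj
  refine ⟨l, fun ψ hψ => (hl ψ hψ).1, Ded.provable (imp_intro ?_ ?_)⟩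
  · simpa using d
  · exact isSentence_conj fun ψ hψ => (hl ψ hψ).2

/-! #### Quantifiers -/

theorem all_elim {x : ℕ} (h : Ded Ax X (.all x φ)) (c : σ.Const) : Ded Ax X (φ.subst x c) := by
  have := isSentence_all.1 h.isSentence
  exact .mp (.thm (.univ this c) (by simp [this, this.isSentence_subst])) h

theorem ex_intro {x : ℕ} (hφ : φ.FreeOnly x) {c : σ.Const} (h : Ded Ax X (φ.subst x c)) :
    Ded Ax X (.ex x φ) :=
  .mp (.thm (.exist hφ c) (by simp [hφ, hφ.isSentence_subst])) h

theorem consts_conj {l : List (Formula σ)} {c : σ.Const} (hc : c ∈ (conj l).consts) :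
    ∃ φ ∈ l, c ∈ φ.consts := by
  induction l with
  | nil => simp [conj, Formula.top, neg, consts] at hc
  | cons a l ih =>
    rcases hc with hc | hc
    · exact ⟨a, by simp, hc⟩
    · obtain ⟨φ, h, h'⟩ := ih hc
      exact ⟨φ, by simp [h], h'⟩

/-- The hypotheses used are gathered into one conjunction free of `c`, the implication from it is
generalized as a theorem, and the axiom `all_con` moves the quantifier past the conjunction. -/
theorem all_intro {x : ℕ} {c : σ.Const} (hφ : φ.FreeOnly x) (hc : c ∉ φ.consts)
    (hX : ∀ ψ ∈ X, c ∉ ψ.consts) (h : Ded Ax X (φ.subst x c)) : Ded Ax X (.all x φ) := by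
  obtain ⟨l, hl, d⟩ := h.exists_conj
  have hs : (conj l).IsSentence := isSentence_conj fun ψ hψ => (hl ψ hψ).2
  have hcl : c ∉ (conj l).consts := fun h => by
    obtain ⟨ψ, hψ, hcψ⟩ := consts_conj h
    exact hX ψ (hl ψ hψ).1 hcψ
  have hp : Provable Ax (((conj l).imp φ).subst x c) := by
    rw [subst, subst_of_isSentence hs]
    exact Ded.provable (imp_intro (by simpa using d) hs)
  have hf : ((conj l).imp φ).FreeOnly x := Set.union_subset (hs.freeOnly x) hφ
  have hp' : Provable Ax (.all x ((conj l).imp φ)) :=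
    .gen hf (by simp [consts, hcl, hc]) hp
  refine .mp (.mp (.thm (.all_con hs hφ) (by simp [hs, hφ, hf])) (.thm hp' (by simp [hf])))
    (conj_intro fun ψ hψ => .hyp (hl ψ hψ).1 (hl ψ hψ).2)

theorem ex_elim {x : ℕ} {c : σ.Const} (hφ : φ.FreeOnly x) (hc : c ∉ φ.consts)
    (hX : ∀ ψ ∈ X, c ∉ ψ.consts) (hψ : c ∉ ψ.consts) (h : Ded Ax (insert (φ.subst x c) X) ψ) :
    Ded Ax (insert (.ex x φ) X) ψ := by
  have hs := h.isSentence
  have h' := h.imp_intro (hφ.isSentence_subst c)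
  have hf : (φ.imp ψ).FreeOnly x := Set.union_subset hφ (hs.freeOnly x)
  have h'' : Ded Ax X (.all x (φ.imp ψ)) := by
    refine all_intro (c := c) hf (by simp [consts, hc, hψ]) hX ?_
    rwa [subst, subst_of_isSentence hs]
  exact imp_elim (.mp (.thm (.all_ant hφ hs) (by simp [hs, hφ, hf])) h'')

/-! #### Modalities -/

theorem box_mp (h₁ : Ded Ax X (.box (φ.imp ψ))) (h₂ : Ded Ax X (.box φ)) :
    Ded Ax X (.box ψ) := by
  have hs := isSentence_imp.1 (isSentence_box.1 h₁.isSentence)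
  have hi : (φ.imp ψ).IsSentence := isSentence_imp.2 hs
  have h := and_intro h₁ h₂
  have e := Ded.thm (X := X) (Provable.box_and (Ax := Ax) hi hs.1)
    (by simp [Formula.iff, hs.1, hs.2])
  have hb := Ded.mp e.and_right h
  refine .mp (.thm (.reg_box (φ := (φ.imp ψ).and φ) (Ded.provable ?_)) (by simp [hs])) hb
  have : Ded Ax (insert ((φ.imp ψ).and φ) ∅) ((φ.imp ψ).and φ) := hyp_insert (by simp [hs])
  exact imp_intro (this.and_left.mp this.and_right) (by simp [hs])

/-- Normality of □ for arbitrary sets of hypotheses. It is applied to the sentences whose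
necessitations lie in a theory. -/
theorem box_intro (h : Ded Ax {φ | φ.box ∈ X} ψ) : Ded Ax X (.box ψ) := by
  induction h with
  | hyp h hs => exact .hyp h hs
  | @thm ψ h hs =>
    refine .mp (.thm (.reg_box (φ := Formula.top) ?_) (by simp [hs])) (.thm .box_top (by simp))
    exact Ded.provable (imp_intro (.thm h hs) (by simp))
  | mp _ _ ih₁ ih₂ => exact box_mp ih₁ ih₂

theorem box_mono (h : Ded Ax {φ} ψ) (hb : Ded Ax X (.box φ)) : Ded Ax X (.box ψ) := by
  have hs := isSentence_box.1 hb.isSentence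
  refine .mp (.thm (.reg_box (Ded.provable (imp_intro (by simpa using h) hs))) ?_) hb
  simp [hs, h.isSentence]

theorem dia_mono (h : Ded Ax {φ} ψ) (hb : Ded Ax X (.dia φ)) : Ded Ax X (.dia ψ) := by
  have hs := isSentence_dia.1 hb.isSentence
  refine .mp (.thm (.reg_dia (Ded.provable (imp_intro (by simpa using h) hs))) ?_) hb
  simp [hs, h.isSentence]

/-- Since φ entails (φ → ψ) → ψ, the axiom `fs2` is used with φ → ψ in the role of its antecedent.
-/
theorem dia_mp (h₁ : Ded Ax X (.box (φ.imp ψ))) (h₂ : Ded Ax X (.dia φ)) :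
    Ded Ax X (.dia ψ) := by
  have hs := isSentence_imp.1 (isSentence_box.1 h₁.isSentence)
  have h : Ded Ax {φ} ((φ.imp ψ).imp ψ) :=
    imp_intro (.mp (hyp_insert (by simp [hs])) (.hyp (by simp) hs.1)) (by simp [hs])
  exact .mp (.mp (.thm (.fs2 (φ := φ.imp ψ) (by simp [hs]) hs.2) (by simp [hs]))
    (dia_mono h h₂)) h₁

theorem dia_bot (h : Ded Ax X (.dia .bot)) : Ded Ax X .bot :=
  .mp (.thm .dia_bot (by simp)) h

theorem dia_or (h : Ded Ax X (.dia (.or φ ψ))) : Ded Ax X (.or φ.dia ψ.dia) := by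
  have hs := isSentence_or.1 (isSentence_dia.1 h.isSentence)
  exact .mp (and_left (.thm (.dia_or hs.1 hs.2) (by simp [hs]))) h

theorem box_imp (h : Ded Ax X (.imp φ.dia ψ.box)) : Ded Ax X (.box (φ.imp ψ)) := by
  have hs := h.isSentence
  simp only [isSentence_imp, isSentence_dia, isSentence_box] at hs
  exact .mp (.thm (.fs1 hs.1 hs.2) (by simp [hs])) h

/-! #### Equality -/

theorem eq_refl (c : σ.Const) : Ded Ax X (.eq (.const c) (.const c)) :=
  .thm (.id_refl c) (by simp [IsSentence, freeVars, Term.vars])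

theorem eq_subst {x : ℕ} (hφ : φ.FreeOnly x) (hm : φ.ModalFree) {c d : σ.Const}
    (h : Ded Ax X (.eq (.const c) (.const d))) (hc : Ded Ax X (φ.subst x c)) :
    Ded Ax X (φ.subst x d) :=
  .mp (.mp (.thm (.id_sub hφ hm c d) (by simp [hφ.isSentence_subst, h.isSentence])) h) hc

theorem eq_symm {c d : σ.Const} (h : Ded Ax X (.eq (.const c) (.const d))) :
    Ded Ax X (.eq (.const d) (.const c)) := by
  have := eq_subst (x := 0) (φ := .eq (.var 0) (.const c))
    (by simp [FreeOnly, freeVars, Term.vars]) trivial h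
  simp only [subst, Term.subst, if_true] at this
  exact this (eq_refl c)

theorem eq_trans {c d e : σ.Const} (h₁ : Ded Ax X (.eq (.const c) (.const d)))
    (h₂ : Ded Ax X (.eq (.const d) (.const e))) : Ded Ax X (.eq (.const c) (.const e)) := by
  have := eq_subst (x := 0) (φ := .eq (.const c) (.var 0))
    (by simp [FreeOnly, freeVars, Term.vars]) trivial h₂
  simp only [subst, Term.subst, if_true] at this
  exact this h₁

/-! #### Quantifying away constants -/

/-- A sentence has a strongest consequence among the sentences with constants in `K`. -/
theorem exists_exClosure (K : Set σ.Const) {χ : Formula σ} (hχ : χ.IsSentence) :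
    ∃ χ' : Formula σ, χ'.IsSentence ∧ χ'.consts ⊆ K ∩ χ.consts ∧ Ded Ax {χ} χ' ∧
      ∀ (Y : Set (Formula σ)) (ψ : Formula σ), (∀ θ ∈ Y, θ.consts ⊆ K) → ψ.consts ⊆ K →
        Ded Ax (insert χ Y) ψ → Ded Ax (insert χ' Y) ψ := by
  -- The constants outside `K` are removed one at a time by existential quantification; `S` bounds
  -- those still left. Nothing is lost for consequences in `K`, because neither `Y` nor `ψ` contains
  -- the removed constant.
  have key : ∀ S : Set σ.Const, S.Finite → ∀ χ : Formula σ, χ.IsSentence → χ.consts ⊆ K ∪ S →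
      ∃ χ' : Formula σ, χ'.IsSentence ∧ χ'.consts ⊆ K ∩ χ.consts ∧ Ded Ax {χ} χ' ∧
      ∀ (Y : Set (Formula σ)) (ψ : Formula σ), (∀ θ ∈ Y, θ.consts ⊆ K) → ψ.consts ⊆ K →
        Ded Ax (insert χ Y) ψ → Ded Ax (insert χ' Y) ψ := by
    intro S hS
    induction S, hS using Set.Finite.induction_on with
    | empty =>
      intro χ hχ h
      rw [Set.union_empty] at h
      exact ⟨χ, hχ, fun c hc => ⟨h hc, hc⟩, .hyp rfl hχ, fun _ _ _ _ h => h⟩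
    | @insert c S _ _ ih =>
      intro χ hχ h
      by_cases hcK : c ∈ K
      · exact ih χ hχ fun d hd => by
          rcases h hd with h | rfl | h
          exacts [.inl h, .inl hcK, .inr h]
      obtain ⟨x, hx⟩ := χ.exists_not_mem_allVars
      have hf : (χ.abstr c x).FreeOnly x := by
        have := freeVars_abstr c x χ
        rwa [hχ, insert_empty_eq] at this
      have hcs : (Formula.ex x (χ.abstr c x)).consts ⊆ χ.consts \ {c} := consts_abstr c x χ
      have hc : c ∉ (χ.abstr c x).consts := fun h => (hcs h).2 rfl
      obtain ⟨χ', h₁, h₂, h₃, h₄⟩ := ih (.ex x (χ.abstr c x)) (by simp [hf]) fun d hd => by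
        rcases h (hcs hd).1 with h | h | h
        exacts [.inl h, ((hcs hd).2 h).elim, .inr h]
      refine ⟨χ', h₁, fun d hd => ⟨(h₂ hd).1, (hcs (h₂ hd).2).1⟩, h₃.cut ?_, ?_⟩
      · rintro _ rfl _
        exact ex_intro hf (c := c) (by rw [subst_abstr c hx]; exact .hyp rfl hχ)
      · intro Y ψ hY hψ hd
        refine h₄ Y ψ hY hψ (ex_elim (c := c) hf hc (fun θ hθ h => hcK (hY θ hθ h))
          (fun h => hcK (hψ h)) ?_)
        rwa [subst_abstr c hx]
  exact key _ χ.finite_consts χ hχ Set.subset_union_right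

/-- A sentence has a weakest strengthening among the sentences with constants in `K`. -/
theorem exists_allClosure (K : Set σ.Const) {χ : Formula σ} (hχ : χ.IsSentence) :
    ∃ χ' : Formula σ, χ'.IsSentence ∧ χ'.consts ⊆ K ∩ χ.consts ∧ Ded Ax {χ'} χ ∧
      ∀ Y : Set (Formula σ), (∀ θ ∈ Y, θ.consts ⊆ K) → Ded Ax Y χ → Ded Ax Y χ' := by
  -- Dually, the foreign constants are universally quantified; this is harmless because the premises
  -- in `Y` do not contain them.
  have key : ∀ S : Set σ.Const, S.Finite → ∀ χ : Formula σ, χ.IsSentence → χ.consts ⊆ K ∪ S →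
      ∃ χ' : Formula σ, χ'.IsSentence ∧ χ'.consts ⊆ K ∩ χ.consts ∧ Ded Ax {χ'} χ ∧
      ∀ Y : Set (Formula σ), (∀ θ ∈ Y, θ.consts ⊆ K) → Ded Ax Y χ → Ded Ax Y χ' := by
    intro S hS
    induction S, hS using Set.Finite.induction_on with
    | empty =>
      intro χ hχ h
      rw [Set.union_empty] at h
      exact ⟨χ, hχ, fun c hc => ⟨h hc, hc⟩, .hyp rfl hχ, fun _ _ h => h⟩
    | @insert c S _ _ ih =>
      intro χ hχ h
      by_cases hcK : c ∈ K
      · exact ih χ hχ fun d hd => by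
          rcases h hd with h | rfl | h
          exacts [.inl h, .inl hcK, .inr h]
      obtain ⟨x, hx⟩ := χ.exists_not_mem_allVars
      have hf : (χ.abstr c x).FreeOnly x := by
        have := freeVars_abstr c x χ
        rwa [hχ, insert_empty_eq] at this
      have hcs : (Formula.all x (χ.abstr c x)).consts ⊆ χ.consts \ {c} := consts_abstr c x χ
      have hc : c ∉ (χ.abstr c x).consts := fun h => (hcs h).2 rfl
      obtain ⟨χ', h₁, h₂, h₃, h₄⟩ := ih (.all x (χ.abstr c x)) (by simp [hf]) fun d hd => by
        rcases h (hcs hd).1 with h | h | h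
        exacts [.inl h, ((hcs hd).2 h).elim, .inr h]
      refine ⟨χ', h₁, fun d hd => ⟨(h₂ hd).1, (hcs (h₂ hd).2).1⟩, ?_, ?_⟩
      · have := h₃.all_elim c
        rwa [subst_abstr c hx] at this
      · intro Y hY hd
        refine h₄ Y hY (all_intro (c := c) hf hc (fun θ hθ h => hcK (hY θ hθ h)) ?_)
        rwa [subst_abstr c hx]
  exact key _ χ.finite_consts χ hχ Set.subset_union_right

end Ded

end FOFS

namespace FOFS

variable {σ : Signature}

/-! ### Soundness -/

open Formula

/-- An interpretation of the predicate symbols on a frame, leaving the constants open. -/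
structure PredInterp (σ : Signature) (F : Frame.{u, v}) where
  pred : F.World → (P : σ.Pred) → Set (Fin (σ.arity P) → F.Obj)
  pred_le : ∀ w w' P, w ≤ w' → pred w P ⊆ pred w' P
  pred_E : ∀ w P a b, (∀ i, F.E w (a i) (b i)) → a ∈ pred w P → b ∈ pred w P

namespace PredInterp

variable {F : Frame.{u, v}}

/-- The denotation of a term under an assignment `κ` to the constants and an assignment `g` to
the variables. -/
def den (κ : σ.Const → F.Obj) (g : ℕ → F.Obj) : Term σ → F.Obj
  | .const c => κ c
  | .var x => g x

/-- Truth at a world under an assignment to the constants and one to the variables. -/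
def Sat (J : PredInterp σ F) (κ : σ.Const → F.Obj) :
    Formula σ → F.World → (ℕ → F.Obj) → Prop
  | .pred P t, w, g => (fun i => den κ g (t i)) ∈ J.pred w P
  | .eq s t, w, g => F.E w (den κ g s) (den κ g t)
  | .bot, _, _ => False
  | .and φ ψ, w, g => J.Sat κ φ w g ∧ J.Sat κ ψ w g
  | .or φ ψ, w, g => J.Sat κ φ w g ∨ J.Sat κ ψ w g
  | .imp φ ψ, w, g => ∀ w', w ≤ w' → J.Sat κ φ w' g → J.Sat κ ψ w' g
  | .box φ, w, g => ∀ w' v, w ≤ w' → F.M w' v → J.Sat κ φ v g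
  | .dia φ, w, g => ∃ v, F.M w v ∧ J.Sat κ φ v g
  | .all x φ, w, g => ∀ w', w ≤ w' → ∀ a ∈ F.D w', J.Sat κ φ w' (Function.update g x a)
  | .ex x φ, w, g => ∃ a ∈ F.D w, J.Sat κ φ w (Function.update g x a)

variable (J : PredInterp σ F)

/-- Persistence is built into the clauses for →, □ and ∀; for ◇ it is FC2. -/
theorem Sat.le {J : PredInterp σ F} {κ : σ.Const → F.Obj} {φ : Formula σ} {w w' : F.World}
    {g : ℕ → F.Obj} (h : J.Sat κ φ w g) (hw : w ≤ w') : J.Sat κ φ w' g := by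
  induction φ generalizing w w' g with
  | pred P t => exact J.pred_le _ _ _ hw h
  | eq s t => exact F.E_le _ _ _ _ hw h
  | bot => exact h
  | and φ ψ ih₁ ih₂ => exact ⟨ih₁ h.1 hw, ih₂ h.2 hw⟩
  | or φ ψ ih₁ ih₂ => exact h.imp (ih₁ · hw) (ih₂ · hw)
  | imp φ ψ ih₁ ih₂ => exact fun u hu => h u (hw.trans hu)
  | box φ ih => exact fun u v hu => h u v (hw.trans hu)
  | dia φ ih =>
    obtain ⟨v, hv, hφ⟩ := h
    obtain ⟨v', hv', hm⟩ := F.fc2 _ _ _ hv hw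
    exact ⟨v', hm, ih hφ hv'⟩
  | all x φ ih => exact fun u hu => h u (hw.trans hu)
  | ex x φ ih =>
    obtain ⟨a, ha, hφ⟩ := h
    exact ⟨a, F.D_le _ _ hw ha, ih hφ hw⟩

theorem den_congr {κ κ' : σ.Const → F.Obj} {g g' : ℕ → F.Obj} {t : Term σ}
    (hc : ∀ c ∈ t.consts, κ c = κ' c) (hv : ∀ x ∈ t.vars, g x = g' x) :
    den κ g t = den κ' g' t := by
  cases t <;> simp_all [den, Term.consts, Term.vars]

theorem sat_congr {κ κ' : σ.Const → F.Obj} {φ : Formula σ} {w : F.World} {g g' : ℕ → F.Obj}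
    (hc : ∀ c ∈ φ.consts, κ c = κ' c) (hv : ∀ x ∈ φ.freeVars, g x = g' x) :
    J.Sat κ φ w g ↔ J.Sat κ' φ w g' := by
  induction φ generalizing w g g' with
  | pred P t =>
    have : (fun i => den κ g (t i)) = fun i => den κ' g' (t i) := funext fun i =>
      den_congr (fun c h => hc c (Set.mem_iUnion.2 ⟨i, h⟩))
        (fun c h => hv c (Set.mem_iUnion.2 ⟨i, h⟩))
    simp only [Sat, this]
  | eq s t =>
    simp only [Sat]
    rw [den_congr (fun c h => hc c (.inl h)) (fun x h => hv x (.inl h)),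
      den_congr (fun c h => hc c (.inr h)) (fun x h => hv x (.inr h))]
  | bot => rfl
  | and φ ψ ih₁ ih₂ | or φ ψ ih₁ ih₂ | imp φ ψ ih₁ ih₂ =>
    have h₁ := fun w => ih₁ (w := w) (fun c h => hc c (.inl h)) (fun x h => hv x (.inl h))
    have h₂ := fun w => ih₂ (w := w) (fun c h => hc c (.inr h)) (fun x h => hv x (.inr h))
    simp only [Sat, h₁, h₂]
  | box φ ih | dia φ ih => simp only [Sat, ih hc hv]
  | all y φ ih | ex y φ ih =>
    have := fun w a => ih (w := w) (g := Function.update g y a) (g' := Function.update g' y a) hc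
      fun x hx => by
        by_cases hxy : x = y
        · subst hxy; simp
        · simpa [hxy] using hv x ⟨hx, hxy⟩
    simp only [Sat, this]

theorem sat_update_var {κ : σ.Const → F.Obj} {φ : Formula σ} (hφ : φ.IsSentence) {w : F.World}
    {g : ℕ → F.Obj} (x : ℕ) (a : F.Obj) :
    J.Sat κ φ w (Function.update g x a) ↔ J.Sat κ φ w g :=
  J.sat_congr (fun _ _ => rfl) fun y hy => by rw [hφ] at hy; exact hy.elim

theorem den_subst (κ : σ.Const → F.Obj) (g : ℕ → F.Obj) (x : ℕ) (c : σ.Const) (t : Term σ) :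
    den κ g (t.subst x c) = den κ (Function.update g x (κ c)) t := by
  cases t with
  | const d => rfl
  | var y => by_cases hy : y = x <;> simp [Term.subst, den, hy]

theorem sat_subst {κ : σ.Const → F.Obj} {φ : Formula σ} {w : F.World} {g : ℕ → F.Obj} {x : ℕ}
    {c : σ.Const} : J.Sat κ (φ.subst x c) w g ↔ J.Sat κ φ w (Function.update g x (κ c)) := by
  induction φ generalizing w g with
  | all y φ ih | ex y φ ih =>
    by_cases hy : y = x
    · subst hy; simp [subst, Sat]
    · simp only [subst, hy, if_false, Sat, ih, Function.update_comm (Ne.symm hy)]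
  | _ => simp_all [subst, Sat, den_subst]

theorem den_E {κ : σ.Const → F.Obj} {w : F.World} {g g' : ℕ → F.Obj}
    (hκ : ∀ c, κ c ∈ F.D w) (hg : ∀ x, F.E w (g x) (g' x)) (t : Term σ) :
    F.E w (den κ g t) (den κ g' t) := by
  cases t with
  | const c => exact F.E_refl _ _ (hκ c)
  | var x => exact hg x

/-- The equivalences grow along ≤ but not along M, hence the restriction to formulas without
modalities. -/
theorem sat_E {κ : σ.Const → F.Obj} {φ : Formula σ} (hφ : φ.ModalFree) {w : F.World}
    {g g' : ℕ → F.Obj} (hκ : ∀ c, κ c ∈ F.D w) (hg : ∀ x, F.E w (g x) (g' x)) :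
    J.Sat κ φ w g ↔ J.Sat κ φ w g' := by
  induction φ generalizing w g g' with
  | pred P t =>
    exact ⟨J.pred_E _ _ _ _ fun i => den_E hκ hg (t i),
      J.pred_E _ _ _ _ fun i => F.E_symm _ _ _ (den_E hκ hg (t i))⟩
  | eq s t =>
    have hs := den_E hκ hg s
    have ht := den_E hκ hg t
    exact ⟨fun h => F.E_trans _ _ _ _ (F.E_trans _ _ _ _ (F.E_symm _ _ _ hs) h) ht,
      fun h => F.E_trans _ _ _ _ (F.E_trans _ _ _ _ hs h) (F.E_symm _ _ _ ht)⟩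
  | bot => rfl
  | and φ ψ ih₁ ih₂ => exact and_congr (ih₁ hφ.1 hκ hg) (ih₂ hφ.2 hκ hg)
  | or φ ψ ih₁ ih₂ => exact or_congr (ih₁ hφ.1 hκ hg) (ih₂ hφ.2 hκ hg)
  | imp φ ψ ih₁ ih₂ =>
    refine forall₂_congr fun w' hw => ?_
    have hκ' := fun c => F.D_le _ _ hw (hκ c)
    have hg' := fun x => F.E_le _ _ _ _ hw (hg x)
    exact imp_congr (ih₁ hφ.1 hκ' hg') (ih₂ hφ.2 hκ' hg')
  | box φ ih | dia φ ih => exact hφ.elim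
  | all y φ ih =>
    refine forall₄_congr fun w' hw a ha => ?_
    refine ih hφ (fun c => F.D_le _ _ hw (hκ c)) fun x => ?_
    by_cases hxy : x = y
    · subst hxy; simpa using F.E_refl _ _ ha
    · simpa [hxy] using F.E_le _ _ _ _ hw (hg x)
  | ex y φ ih =>
    refine exists_congr fun a => and_congr_right fun ha => ?_
    refine ih hφ hκ fun x => ?_
    by_cases hxy : x = y
    · subst hxy; simpa using F.E_refl _ _ ha
    · simpa [hxy] using hg x

theorem sat_inst {A : PForm} (hA : IPC A) (s : ℕ → Formula σ) (κ : σ.Const → F.Obj)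
    (w : F.World) (g : ℕ → F.Obj) : J.Sat κ (A.inst s) w g := by
  induction hA generalizing w with
  | k A B => exact fun w₁ _ hA w₂ h₂ _ => hA.le h₂
  | s A B C =>
    exact fun w₁ _ h w₂ h₂ h' w₃ h₃ hA => h w₃ (h₂.trans h₃) hA w₃ le_rfl (h' w₃ h₃ hA)
  | and_left A B => exact fun w₁ _ h => h.1
  | and_right A B => exact fun w₁ _ h => h.2
  | and_intro A B => exact fun w₁ _ h w₂ h₂ h' => ⟨h.le h₂, h'⟩
  | or_left A B => exact fun w₁ _ h => .inl h
  | or_right A B => exact fun w₁ _ h => .inr h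
  | or_elim A B C =>
    exact fun w₁ _ h w₂ h₂ h' w₃ h₃ hAB => hAB.elim (h w₃ (h₂.trans h₃)) (h' w₃ h₃)
  | exfalso A => exact fun w₁ _ h => h.elim
  | mp _ _ ih₁ ih₂ => exact ih₁ w w le_rfl (ih₂ w)

/-- The constants vary in the induction: for generalization, `c` is made to denote an arbitrary
element of the current domain. The modal rules pass to later worlds, where the values remain
admissible since domains grow along both relations. -/
theorem sat_of_provable (hF : F ∈ serialFrames ∩ transitiveFrames) {φ : Formula σ}
    (h : Provable (axFOFSD4 σ) φ) (κ : σ.Const → F.Obj) (w : F.World) (g : ℕ → F.Obj)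
    (hκ : ∀ c, κ c ∈ F.D w) (hg : ∀ x, g x ∈ F.D w) : J.Sat κ φ w g := by
  classical
  induction h generalizing κ w g with
  | extra h =>
    rcases h with ⟨φ, _, rfl⟩ | ⟨φ, _, rfl⟩ | ⟨φ, _, rfl⟩
    · intro w₁ _ h
      obtain ⟨v, hv⟩ := hF.1 w₁
      exact ⟨v, hv, h w₁ v le_rfl hv⟩
    · intro w₁ _ h w₂ v h₂ hv v' u hv' hu
      -- FC1 turns w₂ M v ≤ v' M u into w₂ ≤ w₃ M v' M u, to which transitivity applies.
      obtain ⟨w₃, h₃, hm⟩ := F.fc1 _ _ _ hv hv'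
      exact h w₃ u (h₂.trans h₃) (hF.2 _ _ _ hm hu)
    · rintro w₁ _ ⟨v, hv, u, hu, h⟩
      exact ⟨u, hF.2 _ _ _ hv hu, h⟩
  | int hA s _ => exact J.sat_inst hA s κ w g
  | box_and =>
    exact ⟨fun w₁ _ h => ⟨fun w₂ v h₂ hv => (h w₂ v h₂ hv).1, fun w₂ v h₂ hv => (h w₂ v h₂ hv).2⟩,
      fun w₁ _ h w₂ v h₂ hv => ⟨h.1 w₂ v h₂ hv, h.2 w₂ v h₂ hv⟩⟩
  | box_top => exact fun w₁ v _ _ v' _ h => h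
  | dia_or =>
    refine ⟨fun w₁ _ h => ?_, fun w₁ _ h => ?_⟩
    · obtain ⟨v, hv, h | h⟩ := h
      exacts [.inl ⟨v, hv, h⟩, .inr ⟨v, hv, h⟩]
    · obtain ⟨v, hv, h⟩ | ⟨v, hv, h⟩ := h
      exacts [⟨v, hv, .inl h⟩, ⟨v, hv, .inr h⟩]
  | dia_bot => exact fun w₁ _ ⟨_, _, h⟩ => h
  | fs1 =>
    intro w₁ _ h w₂ v h₂ hv v' hv' hφ
    obtain ⟨w₃, h₃, hm⟩ := F.fc1 _ _ _ hv hv'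
    exact h w₃ (h₂.trans h₃) ⟨v', hm, hφ⟩ w₃ v' le_rfl hm
  | fs2 =>
    rintro w₁ _ ⟨v, hv, h⟩ w₂ h₂ hb
    obtain ⟨v', hv', hm⟩ := F.fc2 _ _ _ hv h₂
    exact ⟨v', hm, h v' hv' (hb w₂ v' le_rfl hm)⟩
  | univ _ c => exact fun w₁ h₁ h => J.sat_subst.2 (h w₁ le_rfl _ (F.D_le _ _ h₁ (hκ c)))
  | exist _ c => exact fun w₁ h₁ h => ⟨_, F.D_le _ _ h₁ (hκ c), J.sat_subst.1 h⟩
  | all_ant _ hψ =>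
    rintro w₁ _ h w₂ h₂ ⟨a, ha, hφ⟩
    exact (J.sat_update_var hψ _ _).1 (h w₂ h₂ a ha w₂ le_rfl hφ)
  | all_con hφ _ =>
    intro w₁ _ h w₂ h₂ hs w₃ h₃ a ha
    exact h w₃ (h₂.trans h₃) a ha w₃ le_rfl ((J.sat_update_var hφ _ _).2 (hs.le h₃))
  | id_refl c => exact F.E_refl _ _ (hκ c)
  | @id_sub x φ _ hm c₁ c₂ =>
    intro w₁ h₁ he w₂ h₂ h
    have hκ' := fun c => F.D_le _ _ (h₁.trans h₂) (hκ c)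
    refine J.sat_subst.2 ((J.sat_E hm hκ' fun y => ?_).1 (J.sat_subst.1 h))
    by_cases hy : y = x
    · subst hy; simpa [den] using F.E_le _ _ _ _ h₂ he
    · simpa [hy] using F.E_refl _ _ (F.D_le _ _ (h₁.trans h₂) (hg y))
  | mp _ _ ih₁ ih₂ => exact ih₁ κ w g hκ hg w le_rfl (ih₂ κ w g hκ hg)
  | @gen x φ c _ hc _ ih =>
    intro w₁ h₁ a ha
    have := J.sat_subst.1 (ih (Function.update κ c a) w₁ g (fun d => by
      by_cases hd : d = c
      · subst hd; simpa using ha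
      · simpa [hd] using F.D_le _ _ h₁ (hκ d)) fun y => F.D_le _ _ h₁ (hg y))
    rw [Function.update_self] at this
    refine (J.sat_congr (fun d hd => ?_) fun _ _ => rfl).1 this
    exact Function.update_of_ne (by rintro rfl; exact hc hd) _ _
  | reg_box _ ih =>
    intro w₁ h₁ h w₂ v h₂ hv
    have hD : F.D w ⊆ F.D v := (F.D_le _ _ (h₁.trans h₂)).trans (F.D_M _ _ hv)
    exact ih κ v g (fun c => hD (hκ c)) (fun x => hD (hg x)) v le_rfl (h w₂ v h₂ hv)
  | reg_dia _ ih =>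
    rintro w₁ h₁ ⟨v, hv, h⟩
    have hD : F.D w ⊆ F.D v := (F.D_le _ _ h₁).trans (F.D_M _ _ hv)
    exact ⟨v, hv, ih κ v g (fun c => hD (hκ c)) (fun x => hD (hg x)) v le_rfl h⟩

end PredInterp

namespace Interp

variable {F : Frame.{u, v}} (I : Interp σ F)

/-- The predicate part of an interpretation. -/
def toPredInterp : PredInterp σ F := ⟨I.pred, I.pred_le, I.pred_E⟩

theorem sat_toPredInterp {φ : Formula σ} {w : F.World} {g : ℕ → F.Obj} :
    I.toPredInterp.Sat I.const φ w g ↔ I.Sat φ w g := by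
  have hd (g : ℕ → F.Obj) (t : Term σ) : PredInterp.den I.const g t = I.den g t := by
    cases t <;> rfl
  induction φ generalizing w g with
  | pred P t => simp only [PredInterp.Sat, Sat, hd, toPredInterp]
  | eq s t => simp only [PredInterp.Sat, Sat, hd]
  | _ => simp_all [PredInterp.Sat, Sat]

end Interp

theorem Derives.entails {Γ : Set (Formula σ)} {φ : Formula σ} (h : Derives (axFOFSD4 σ) Γ φ) :
    Entails (serialFrames.{u, v} ∩ transitiveFrames.{u, v}) Γ φ := by
  intro F hF I w hΓ g hg
  obtain ⟨l, hl, hp⟩ := h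
  have himp := I.toPredInterp.sat_of_provable hF hp I.const w g (fun c => I.const_mem c w) hg
  refine I.sat_toPredInterp.1 (himp w le_rfl ?_)
  clear himp hp
  induction l with
  | nil => exact fun _ _ h => h
  | cons a l ih =>
    exact ⟨I.sat_toPredInterp.2 (hΓ a (hl a (by simp)) g hg), ih fun γ hγ => hl γ (by simp [hγ])⟩

end FOFS

namespace FOFS

variable {σ : Signature} {Ax : Set (Formula σ)}

/-! ### Prime theories with witnesses -/

open Formula

/-- `φ` is a sentence in the language with constants `K`. -/
def InLang (K : Set σ.Const) (φ : Formula σ) : Prop := φ.IsSentence ∧ φ.consts ⊆ K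

theorem InLang.mono {K K' : Set σ.Const} {φ : Formula σ} (h : InLang K φ) (hK : K ⊆ K') :
    InLang K' φ := ⟨h.1, h.2.trans hK⟩

/-- `T` is a prime theory with witnesses in the language with constants `K`. -/
structure IsTheory (Ax : Set (Formula σ)) (K : Set σ.Const) (T : Set (Formula σ)) : Prop where
  inLang : ∀ φ ∈ T, InLang K φ
  closed : ∀ φ, InLang K φ → Ded Ax T φ → φ ∈ T
  bot : Formula.bot ∉ T
  prime : ∀ φ ψ, φ.or ψ ∈ T → φ ∈ T ∨ ψ ∈ T
  witness : ∀ x φ, .ex x φ ∈ T → ∃ c ∈ K, φ.subst x c ∈ T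

/-- Only the hypotheses from `X` are made finite, so that their conjunction can be quantified or
moved across the turnstile while `Y`, later the sentences necessary at a theory, stays whole. -/
theorem Ded.exists_conj_union {X Y : Set (Formula σ)} {φ : Formula σ} (h : Ded Ax (X ∪ Y) φ) :
    ∃ l : List (Formula σ), (∀ ψ ∈ l, ψ ∈ X ∧ ψ.IsSentence) ∧ Ded Ax (insert (conj l) Y) φ := by
  classical
  obtain ⟨l, hl, d⟩ := h.compact
  refine ⟨l.filter (· ∈ X), fun ψ hψ => ?_, d.cut fun ψ hψ hs => ?_⟩
  · simp only [List.mem_filter, decide_eq_true_eq] at hψ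
    exact ⟨hψ.2, (hl ψ hψ.1).2⟩
  · by_cases hX : ψ ∈ X
    · refine of_mem_conj (l := l.filter (· ∈ X)) (hyp_insert ?_) (by simp [hX]; exact hψ)
      refine isSentence_conj fun θ hθ => (hl θ ?_).2
      exact (List.mem_filter.1 hθ).1
    · exact .hyp (.inr ((hl ψ hψ).1.resolve_left hX)) hs

/-- A directed set of sentences, seen as a generalized disjunction. -/
structure IsDirected (Ax B : Set (Formula σ)) : Prop where
  nonempty : B.Nonempty
  directed : ∀ β₁ ∈ B, ∀ β₂ ∈ B, ∃ β ∈ B, Ded Ax {β₁} β ∧ Ded Ax {β₂} β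

theorem isDirected_singleton {φ : Formula σ} (hφ : φ.IsSentence) : IsDirected Ax {φ} :=
  ⟨⟨φ, rfl⟩, by rintro _ rfl _ rfl; exact ⟨_, rfl, .hyp rfl hφ, .hyp rfl hφ⟩⟩

section Lindenbaum

variable {K N : Set σ.Const} {X B : Set (Formula σ)}

/-- If χ may be added without implying a member of `B`, so may a witness for it: the constant is
taken from `N` outside the finitely many used so far, and it does not occur in `X` or `B`, whose
language is `K`. -/
theorem lindenbaum_step (hN : N.Infinite) (hKN : Disjoint K N) (hX : ∀ φ ∈ X, InLang K φ)
    (hB : ∀ φ ∈ B, InLang K φ) {F : Set (Formula σ)} (hF : F.Finite)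
    (hFL : ∀ φ ∈ F, InLang (K ∪ N) φ) (hav : ∀ β ∈ B, ¬ Ded Ax (X ∪ F) β) (χ : Formula σ)
    (hχ : InLang (K ∪ N) χ) :
    ∃ F' : Set (Formula σ), F'.Finite ∧ (∀ φ ∈ F', InLang (K ∪ N) φ) ∧
      (∀ β ∈ B, ¬ Ded Ax (X ∪ F') β) ∧ F ⊆ F' ∧
      ((χ ∈ F' ∧ ∀ x φ, χ = .ex x φ → ∃ c ∈ N, φ.subst x c ∈ F') ∨
        ∃ β ∈ B, Ded Ax (insert χ (X ∪ F)) β) := by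
  by_cases h : ∃ β ∈ B, Ded Ax (insert χ (X ∪ F)) β
  · exact ⟨F, hF, hFL, hav, subset_rfl, .inr h⟩
  push Not at h
  by_cases hex : ∃ x φ, χ = .ex x φ
  · obtain ⟨x, φ, rfl⟩ := hex
    have hfin : (φ.consts ∪ ⋃ ψ ∈ F, ψ.consts).Finite :=
      φ.finite_consts.union (hF.biUnion fun ψ _ => ψ.finite_consts)
    obtain ⟨c, hcN, hc⟩ := (hN.sdiff hfin).nonempty
    simp only [Set.mem_union, Set.mem_iUnion, not_or, not_exists] at hc
    have hcK : c ∉ K := fun h => hKN.le_bot ⟨h, hcN⟩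
    have hφ := isSentence_ex.1 hχ.1
    refine ⟨insert (φ.subst x c) (insert (.ex x φ) F), (hF.insert _).insert _, ?_, ?_, ?_, .inl
      ⟨by simp, ?_⟩⟩
    · rintro ψ (rfl | rfl | hψ)
      · refine ⟨hφ.isSentence_subst c, (consts_subst φ x c).trans ?_⟩
        exact Set.insert_subset (.inr hcN) hχ.2
      · exact hχ
      · exact hFL ψ hψ
    · intro β hβ hd
      have hd' : Ded Ax (insert (φ.subst x c) (insert (.ex x φ) (X ∪ F))) β := by
        rwa [Set.union_insert, Set.union_insert] at hd
      have := Ded.ex_elim hφ hc.1 ?_ (fun h => hcK ((hB β hβ).2 h)) hd'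
      · rw [Set.insert_idem] at this
        exact h β hβ this
      · rintro ψ (rfl | hψ | hψ) h'
        · exact hc.1 h'
        · exact hcK ((hX ψ hψ).2 h')
        · exact hc.2 ψ hψ h'
    · exact (Set.subset_insert _ _).trans (Set.subset_insert _ _)
    · intro y ψ he
      cases he
      exact ⟨c, hcN, .inl rfl⟩
  · refine ⟨insert χ F, hF.insert _, ?_, ?_, Set.subset_insert _ _, .inl ⟨.inl rfl, ?_⟩⟩
    · rintro ψ (rfl | hψ)
      exacts [hχ, hFL ψ hψ]
    · intro β hβ hd
      rw [Set.union_insert] at hd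
      exact h β hβ hd
    · exact fun x φ he => (hex ⟨x, φ, he⟩).elim

/-- A set of sentences that implies no member of the directed set `B` extends, with witnesses
from the infinite set `N` of new constants, to a prime theory that is maximal with that
property. -/
theorem exists_theory (hN : N.Infinite) (hKN : Disjoint K N) (hX : ∀ φ ∈ X, InLang K φ)
    (hB : ∀ φ ∈ B, InLang K φ) (hdir : IsDirected Ax B) (hav : ∀ β ∈ B, ¬ Ded Ax X β) :
    ∃ T, IsTheory Ax (K ∪ N) T ∧ X ⊆ T ∧ (∀ β ∈ B, ¬ Ded Ax T β) ∧
      ∀ χ, InLang (K ∪ N) χ → χ ∉ T → ∃ β ∈ B, Ded Ax (insert χ T) β := by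
  have : Nonempty (Formula σ) := ⟨.bot⟩
  obtain ⟨e, he⟩ := exists_surjective_nat (Formula σ)
  -- Only finitely many sentences are added to `X` at each stage, so a fresh constant of `N` always
  -- remains.
  let Stage := {F : Set (Formula σ) // F.Finite ∧ (∀ φ ∈ F, InLang (K ∪ N) φ) ∧
    ∀ β ∈ B, ¬ Ded Ax (X ∪ F) β}
  have step : ∀ (F : Stage) (χ : Formula σ), ∃ F' : Stage, F.1 ⊆ F'.1 ∧ (InLang (K ∪ N) χ →
      ((χ ∈ F'.1 ∧ ∀ x φ, χ = .ex x φ → ∃ c ∈ N, φ.subst x c ∈ F'.1) ∨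
        ∃ β ∈ B, Ded Ax (insert χ (X ∪ F.1)) β)) := by
    rintro ⟨F, h₁, h₂, h₃⟩ χ
    by_cases hχ : InLang (K ∪ N) χ
    · obtain ⟨F', h₁', h₂', h₃', hs, h⟩ := lindenbaum_step hN hKN hX hB h₁ h₂ h₃ χ hχ
      exact ⟨⟨F', h₁', h₂', h₃'⟩, hs, fun _ => h⟩
    · exact ⟨⟨F, h₁, h₂, h₃⟩, subset_rfl, fun h => (hχ h).elim⟩
  choose next hsub hnext using step
  let start : Stage := ⟨∅, Set.finite_empty, by simp, by simpa using hav⟩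
  let seq : ℕ → Stage := fun n => n.rec start fun n F => next F (e n)
  have hmono : Monotone fun n => (seq n).1 := monotone_nat_of_le_succ fun n => hsub (seq n) (e n)
  let T := X ∪ ⋃ n, (seq n).1
  have hT : ∀ β ∈ B, ¬ Ded Ax T β := by
    intro β hβ hd
    obtain ⟨l, hl, hd⟩ := hd.compact
    have : ∃ n, ∀ ψ ∈ l, ψ ∈ X ∪ (seq n).1 := by
      clear hd
      induction l with
      | nil => exact ⟨0, by simp⟩
      | cons a l ih =>
        obtain ⟨n, hn⟩ := ih fun ψ hψ => hl ψ (by simp [hψ])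
        obtain ⟨m, hm⟩ : ∃ m, a ∈ X ∪ (seq m).1 := by
          rcases (hl a (by simp)).1 with h | h
          · exact ⟨0, .inl h⟩
          · obtain ⟨m, hm⟩ := Set.mem_iUnion.1 h
            exact ⟨m, .inr hm⟩
        refine ⟨max m n, fun ψ hψ => ?_⟩
        rcases List.mem_cons.1 hψ with rfl | hψ
        · exact hm.imp_right fun h => hmono (le_max_left _ _) h
        · exact (hn ψ hψ).imp_right fun h => hmono (le_max_right _ _) h
    obtain ⟨n, hn⟩ := this
    exact (seq n).2.2.2 β hβ (hd.mono hn)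
  have hseqT : ∀ n, (seq n).1 ⊆ T := fun n => (Set.subset_iUnion (fun n => (seq n).1) n).trans
    Set.subset_union_right
  have hdec : ∀ χ, InLang (K ∪ N) χ →
      (χ ∈ T ∧ ∀ x φ, χ = .ex x φ → ∃ c ∈ N, φ.subst x c ∈ T) ∨
        ∃ β ∈ B, Ded Ax (insert χ T) β := by
    intro χ hχ
    obtain ⟨n, rfl⟩ := he χ
    rcases hnext (seq n) (e n) hχ with ⟨h, h'⟩ | ⟨β, hβ, hd⟩
    · refine .inl ⟨hseqT (n + 1) h, fun x φ hx => ?_⟩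
      obtain ⟨c, hc, hφ⟩ := h' x φ hx
      exact ⟨c, hc, hseqT (n + 1) hφ⟩
    · refine .inr ⟨β, hβ, hd.mono (Set.insert_subset_insert ?_)⟩
      exact Set.union_subset_union_right _ (Set.subset_iUnion (fun n => (seq n).1) n)
  have hmax : ∀ χ, InLang (K ∪ N) χ → χ ∉ T → ∃ β ∈ B, Ded Ax (insert χ T) β :=
    fun χ hχ h => (hdec χ hχ).resolve_left fun h' => h h'.1
  have hTL : ∀ φ ∈ T, InLang (K ∪ N) φ := by
    rintro φ (h | h)
    · exact (hX φ h).mono Set.subset_union_left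
    · obtain ⟨n, hn⟩ := Set.mem_iUnion.1 h
      exact (seq n).2.2.1 φ hn
  refine ⟨T, ⟨hTL, ?_, ?_, ?_, ?_⟩, Set.subset_union_left, hT, hmax⟩
  · intro φ hφ hd
    by_contra h
    obtain ⟨β, hβ, hd'⟩ := hmax φ hφ h
    exact hT β hβ (hd'.cut_insert hd)
  · intro h
    obtain ⟨β, hβ⟩ := hdir.nonempty
    exact hT β hβ (Ded.exfalso (.hyp h rfl) (hB β hβ).1)
  · intro φ ψ h
    have hL := hTL _ h
    have hs := isSentence_or.1 hL.1
    by_contra! hcon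
    obtain ⟨β₁, hβ₁, d₁⟩ := hmax φ ⟨hs.1, Set.subset_union_left.trans hL.2⟩ hcon.1
    obtain ⟨β₂, hβ₂, d₂⟩ := hmax ψ ⟨hs.2, Set.subset_union_right.trans hL.2⟩ hcon.2
    -- The two disjuncts may lead to different members of `B`; directedness supplies a common
    -- consequence.
    obtain ⟨β, hβ, e₁, e₂⟩ := hdir.directed β₁ hβ₁ β₂ hβ₂
    refine hT β hβ (Ded.or_elim (.hyp h hL.1) (e₁.cut ?_) (e₂.cut ?_))
    · rintro _ rfl _; exact d₁
    · rintro _ rfl _; exact d₂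
  · intro x φ h
    -- An existential sentence may lie in `T` before its turn, for instance in `X`. It still gets a
    -- witness at its own stage, since being rejected there would make `T` imply a member of `B`.
    rcases hdec _ (hTL _ h) with ⟨-, h'⟩ | ⟨β, hβ, hd⟩
    · obtain ⟨c, hc, hφ⟩ := h' x φ rfl
      exact ⟨c, .inr hc, hφ⟩
    · rw [Set.insert_eq_of_mem h] at hd
      exact (hT β hβ hd).elim

end Lindenbaum

end FOFS

namespace FOFS

variable {σ : Signature} {Ax : Set (Formula σ)}

/-! ### Paths of theories -/

open Formula

/-- A level and a theory. A path of theories is a list of layers, with the deepest layer first. -/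
abbrev Layer (σ : Signature) := ℕ × Set (Formula σ)

/-- The constants are sorted by `tag`: those without a tag belong to every world, and those with
tag `(j, l)` are reserved for the layer of depth `j` of a path, if its level exceeds `l`. -/
def lang (tag : σ.Const → Option (ℕ × ℕ)) : List (Layer σ) → Set σ.Const
  | [] => {c | tag c = none}
  | a :: p => lang tag p ∪ {c | ∃ l < a.1, tag c = some (p.length, l)}

/-- The theory of the deepest layer. -/
def top : List (Layer σ) → Set (Formula σ)
  | [] => ∅
  | a :: _ => a.2

/-- The canonical modal accessibility between `S`, in the language with constants `K`, and `T`. -/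
structure Link (K : Set σ.Const) (S T : Set (Formula σ)) : Prop where
  box : ∀ φ, φ.box ∈ S → φ ∈ T
  dia : ∀ φ ∈ T, φ.consts ⊆ K → φ.dia ∈ S

/-- Each layer holds a theory in its language that is accessible from the layer before. -/
def IsPath (Ax : Set (Formula σ)) (tag : σ.Const → Option (ℕ × ℕ)) : List (Layer σ) → Prop
  | [] => True
  | a :: p => IsTheory Ax (lang tag (a :: p)) a.2 ∧ IsPath Ax tag p ∧
      (p ≠ [] → Link (lang tag p) (top p) a.2)

/-- The layerwise order of paths. -/
abbrev PathLE (p q : List (Layer σ)) : Prop := List.Forall₂ (· ≤ ·) p q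

variable {tag : σ.Const → Option (ℕ × ℕ)}

/-! ### Bookkeeping of languages along a path -/

theorem tag_of_mem_lang {p : List (Layer σ)} {c : σ.Const} (h : c ∈ lang tag p) :
    tag c = none ∨ ∃ j l, j < p.length ∧ tag c = some (j, l) := by
  induction p with
  | nil => exact .inl h
  | cons a p ih =>
    rcases h with h | ⟨l, -, h⟩
    · rcases ih h with h | ⟨j, l, hj, h⟩
      · exact .inl h
      · exact .inr ⟨j, l, by simp; omega, h⟩
    · exact .inr ⟨p.length, l, by simp, h⟩

theorem lang_subset_cons (a : Layer σ) (p : List (Layer σ)) : lang tag p ⊆ lang tag (a :: p) :=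
  Set.subset_union_left

theorem lang_subset_append (l p : List (Layer σ)) : lang tag p ⊆ lang tag (l ++ p) := by
  induction l with
  | nil => exact subset_rfl
  | cons a l ih => exact ih.trans (lang_subset_cons a _)

theorem base_subset_lang (p : List (Layer σ)) : {c | tag c = none} ⊆ lang tag p := by
  have := lang_subset_append (tag := tag) p []
  rwa [List.append_nil] at this

theorem PathLE.lang_subset {p q : List (Layer σ)} (h : PathLE p q) :
    lang tag p ⊆ lang tag q := by
  induction h with
  | nil => exact subset_rfl
  | cons hab hpq ih =>
    refine Set.union_subset_union ih ?_
    rintro c ⟨l, hl, hc⟩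
    exact ⟨l, hl.trans_le hab.1, by rw [hc, hpq.length_eq]⟩

theorem PathLE.top_subset {p q : List (Layer σ)} (h : PathLE p q) : top p ⊆ top q := by
  cases h with
  | nil => exact subset_rfl
  | cons hab _ => exact hab.2

theorem PathLE.of_succ {a : Layer σ} {p q : List (Layer σ)}
    (h : PathLE ((a.1 + 1, a.2) :: p) q) : PathLE (a :: p) q := by
  cases h with
  | cons hab hpq => exact .cons ⟨(Nat.le_succ _).trans hab.1, hab.2⟩ hpq

theorem lang_cons_congr {a b : Layer σ} (h : a.1 = b.1) (p : List (Layer σ)) :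
    lang tag (a :: p) = lang tag (b :: p) := by
  simp [lang, h]

theorem lang_succ (k : ℕ) (S T : Set (Formula σ)) (p : List (Layer σ)) :
    lang tag ((k + 1, T) :: p) = lang tag ((k, S) :: p) ∪ {c | tag c = some (p.length, k)} := by
  ext c
  simp only [lang, Set.mem_union, Set.mem_ofPred_eq, or_assoc, Nat.lt_succ_iff_lt_or_eq]
  refine or_congr_right ⟨?_, ?_⟩
  · rintro ⟨l, hl | rfl, h⟩
    exacts [.inl ⟨l, hl, h⟩, .inr h]
  · rintro (⟨l, hl, h⟩ | h)
    exacts [⟨l, .inl hl, h⟩, ⟨k, .inr rfl, h⟩]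

theorem disjoint_lang (k : ℕ) (S : Set (Formula σ)) (p : List (Layer σ)) :
    Disjoint (lang tag ((k, S) :: p)) {c | tag c = some (p.length, k)} := by
  rw [Set.disjoint_left]
  rintro c (h | ⟨l, hl, h⟩) (h' : tag c = some (p.length, k))
  · rcases tag_of_mem_lang h with h | ⟨j, l, hj, h⟩ <;> rw [h] at h' <;> simp at h'
    omega
  · rw [h] at h'
    simp at h'
    omega

/-- The constants that `a` adds are reserved for depth `p.length`, and `q`, being as long as `p`,
has only smaller depths. So enlarging the earlier layers never uses up constants of the next one. -/
theorem lang_inter_lang_cons {p q : List (Layer σ)} (h : PathLE p q) (a : Layer σ) :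
    lang tag q ∩ lang tag (a :: p) = lang tag p := by
  refine Set.Subset.antisymm ?_ fun c hc => ⟨h.lang_subset hc, .inl hc⟩
  rintro c ⟨hq, hp | ⟨l, -, hl⟩⟩
  · exact hp
  · rcases tag_of_mem_lang hq with h' | ⟨j, l', hj, h'⟩ <;> rw [hl] at h' <;> simp at h'
    have := h.length_eq
    omega

theorem IsPath.isTheory {p : List (Layer σ)} (h : IsPath Ax tag p) (hp : p ≠ []) :
    IsTheory Ax (lang tag p) (top p) := by
  cases p with
  | nil => exact (hp rfl).elim
  | cons a p => exact h.1

theorem IsPath.of_append {l p : List (Layer σ)} (h : IsPath Ax tag (l ++ p)) :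
    IsPath Ax tag p := by
  induction l with
  | nil => exact h
  | cons a l ih => exact ih h.2.1

/-- Along a path, transitivity of the canonical accessibility. -/
theorem IsPath.link (h₄ : axFOFS4 σ ⊆ Ax) {l p : List (Layer σ)} (h : IsPath Ax tag (l ++ p))
    (hl : l ≠ []) (hp : p ≠ []) : Link (lang tag p) (top p) (top (l ++ p)) := by
  induction l with
  | nil => exact (hl rfl).elim
  | cons a l ih =>
    have hlink := h.2.2 (by simp [hp])
    by_cases hl' : l = []
    · subst hl'; exact hlink
    have ih := ih h.2.1 hl'
    have hT := h.of_append.isTheory hp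
    -- Of the two boxes in □□φ, one is spent on reaching the end of `l ++ p` and the other on the
    -- last link. The ◇ half is symmetric.
    refine ⟨fun φ hφ => hlink.box φ (ih.box _ ?_), fun φ hφ hc => ?_⟩
    · have hL := hT.inLang _ hφ
      refine hT.closed _ hL (.mp (.thm (.extra (h₄ (.inl ⟨φ, hL.1, rfl⟩))) ?_) (.hyp hφ hL.1))
      simpa using hL.1
    · have h' := hlink.dia φ hφ (hc.trans (lang_subset_append _ _))
      have h'' := ih.dia _ h' hc
      have hL := hT.inLang _ h''
      refine hT.closed _ hL (.mp (.thm (.extra (h₄ (.inr ⟨φ, hL.1, rfl⟩))) ?_) (.hyp h'' hL.1))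
      simpa using hL.1

/-! ### Prolonging and enlarging paths -/

/-- A set `X` of sentences whose consequences are possible at the end of a path extends to a
further layer. -/
theorem exists_layer_of_dia (htag : ∀ p, {c | tag c = some p}.Infinite) {p : List (Layer σ)}
    (hp : IsPath Ax tag p) (hne : p ≠ []) (k : ℕ) {K : Set σ.Const}
    (hK : K ⊆ lang tag ((k, ∅) :: p)) {X : Set (Formula σ)} (hX : ∀ φ ∈ X, InLang K φ)
    (hdia : ∀ γ, InLang (lang tag p ∩ K) γ → Ded Ax X γ → γ.dia ∈ top p) :
    ∃ T, IsPath Ax tag ((k + 1, T) :: p) ∧ X ⊆ T := by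
  have hT := hp.isTheory hne
  have hs := lang_subset_cons (tag := tag) (k, ∅) p
  -- Avoiding `B` is exactly the ◇ half of the link. `B` is directed because ◇ distributes over ∨,
  -- and nonempty because ◇⊥ is refutable.
  let B : Set (Formula σ) := {α | InLang (lang tag p) α ∧ α.dia ∉ top p}
  have hdir : IsDirected Ax B := by
    refine ⟨⟨.bot, ⟨rfl, Set.empty_subset _⟩, fun h => hT.bot (hT.closed _ ⟨rfl,
      Set.empty_subset _⟩ (Ded.dia_bot (.hyp h rfl)))⟩, ?_⟩
    rintro α ⟨hα, hα'⟩ β ⟨hβ, hβ'⟩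
    refine ⟨α.or β, ⟨⟨isSentence_or.2 ⟨hα.1, hβ.1⟩, Set.union_subset hα.2 hβ.2⟩, fun h => ?_⟩,
      Ded.or_left (.hyp rfl hα.1) hβ.1, Ded.or_right (.hyp rfl hβ.1) hα.1⟩
    have h' := Ded.dia_or (Ax := Ax) (.hyp h (hT.inLang _ h).1)
    rcases hT.prime _ _ (hT.closed _ ⟨h'.isSentence, Set.union_subset hα.2 hβ.2⟩ h') with h | h
    exacts [hα' h, hβ' h]
  obtain ⟨T, hT', hXT, hB, -⟩ := exists_theory (Ax := Ax) (B := B) (htag (p.length, k))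
    (disjoint_lang k ∅ p) (X := X ∪ {δ | δ.box ∈ top p}) (fun φ hφ => by
      rcases hφ with h | h
      · exact (hX φ h).mono hK
      · have := hT.inLang _ h
        exact ⟨this.1, this.2.trans hs⟩) (fun α hα => hα.1.mono hs) hdir (by
      rintro α ⟨hα, hα'⟩ hd
      obtain ⟨l, hl, hd⟩ := hd.exists_conj_union
      have hls : (conj l).IsSentence := isSentence_conj fun ψ hψ => (hl ψ hψ).2
      have hlK : (conj l).consts ⊆ K := fun c hc => by
        obtain ⟨ψ, hψ, hc⟩ := Ded.consts_conj hc
        exact (hX ψ (hl ψ hψ).1).2 hc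
      -- γ carries all that the used part of `X` says in the language of `p`. As ◇γ and □(γ → α)
      -- both hold at the end of `p`, so would ◇α.
      obtain ⟨γ, h₁, h₂, h₃, h₄⟩ := Ded.exists_exClosure (Ax := Ax) (lang tag p) hls
      have hd' := h₄ {δ | δ.box ∈ top p} α (fun θ hθ => (hT.inLang _ hθ).2) hα.2 hd
      have hγ : γ.dia ∈ top p := by
        refine hdia γ ⟨h₁, fun c hc => ⟨(h₂ hc).1, hlK (h₂ hc).2⟩⟩ (h₃.cut ?_)
        rintro _ rfl _
        exact Ded.conj_intro fun ψ hψ => .hyp (hl ψ hψ).1 (hl ψ hψ).2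
      exact hα' (hT.closed _ ⟨hα.1, hα.2⟩
        (Ded.dia_mp (Ded.box_intro (hd'.imp_intro h₁)) (.hyp hγ h₁))))
  rw [← lang_succ k ∅ T p] at hT'
  refine ⟨T, ⟨hT', hp, fun _ => ⟨fun φ hφ => hXT (.inr hφ), fun φ hφ hc => ?_⟩⟩,
    Set.subset_union_left.trans hXT⟩
  by_contra h
  exact hB φ ⟨⟨(hT'.inLang φ hφ).1, hc⟩, h⟩ (.hyp hφ (hT'.inLang φ hφ).1)

/-- An extension of an initial part of a path extends to the whole path. -/
theorem exists_append_extension (htag : ∀ p, {c | tag c = some p}.Infinite)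
    {l p q : List (Layer σ)} (hp : p ≠ []) (hlp : IsPath Ax tag (l ++ p)) (hq : IsPath Ax tag q)
    (hpq : PathLE p q) :
    ∃ l', l'.length = l.length ∧ IsPath Ax tag (l' ++ q) ∧ PathLE (l ++ p) (l' ++ q) := by
  induction l with
  | nil => exact ⟨[], rfl, hq, hpq⟩
  | cons a l ih =>
    obtain ⟨l', hl', hq', hle⟩ := ih hlp.2.1
    have hne : q ≠ [] := by rintro rfl; cases hpq; exact hp rfl
    have hlink := hlp.2.2 (by simp [hp])
    have hK : lang tag (a :: (l ++ p)) ⊆ lang tag ((a.1, ∅) :: (l' ++ q)) :=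
      Set.Subset.trans (lang_cons_congr (b := (a.1, ∅)) rfl _).subset
        (PathLE.lang_subset (.cons le_rfl hle))
    obtain ⟨T, hT, hsub⟩ := exists_layer_of_dia htag hq' (by simp [hne]) a.1 hK hlp.1.inLang
      -- A consequence of the old layer that is expressible over the new path is already in the old
      -- language of `l ++ p`, so the old link makes it possible there, hence in the larger theory
      -- too.
      fun γ hγ hd => by
        have hc : γ.consts ⊆ lang tag (l ++ p) := by
          rw [← lang_inter_lang_cons hle a]; exact hγ.2
        exact hle.top_subset (hlink.dia γ (hlp.1.closed γ
          ⟨hγ.1, hγ.2.trans Set.inter_subset_right⟩ hd) hc)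
    exact ⟨(a.1 + 1, T) :: l', by simp [hl'], hT, .cons ⟨Nat.le_succ _, hsub⟩ hle⟩

/-- If the last theory of the path `p` is maximal among those that imply no `□θ`, for the
sentences `θ` of `K` that together with `X` imply a member of `B`, then `X` extends to a
further layer that is maximal among those that imply no member of `B`. -/
theorem exists_layer_avoiding (htag : ∀ p, {c | tag c = some p}.Infinite) {p : List (Layer σ)}
    (hp : IsPath Ax tag p) (hne : p ≠ []) (k : ℕ) {K : Set σ.Const}
    (hK : K ⊆ lang tag ((k, ∅) :: p)) {X B : Set (Formula σ)} (hX : ∀ φ ∈ X, InLang K φ)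
    (hB : ∀ φ ∈ B, InLang K φ) (hdir : IsDirected Ax B)
    (hav : ∀ θ, InLang (lang tag p ∩ K) θ → (∃ β ∈ B, Ded Ax (insert θ X) β) → θ.box ∉ top p)
    (hmax : ∀ χ, InLang (lang tag p) χ → χ ∉ top p → ∃ θ, InLang (lang tag p ∩ K) θ ∧
      (∃ β ∈ B, Ded Ax (insert θ X) β) ∧ Ded Ax (insert χ (top p)) θ.box) :
    ∃ T, IsPath Ax tag ((k + 1, T) :: p) ∧ X ⊆ T ∧ (∀ β ∈ B, ¬ Ded Ax T β) ∧
      ∀ χ, InLang (lang tag ((k + 1, T) :: p)) χ → χ ∉ T → ∃ β ∈ B, Ded Ax (insert χ T) β := by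
  have hT := hp.isTheory hne
  have hs := lang_subset_cons (tag := tag) (k, ∅) p
  obtain ⟨T, hT', hXT, hBT, hmaxT⟩ := exists_theory (Ax := Ax) (B := B) (htag (p.length, k))
    (disjoint_lang k ∅ p) (X := X ∪ {δ | δ.box ∈ top p}) (fun φ hφ => by
      rcases hφ with h | h
      · exact (hX φ h).mono hK
      · have := hT.inLang _ h
        exact ⟨this.1, this.2.trans hs⟩) (fun β hβ => (hB β hβ).mono hK) hdir (by
      intro β hβ hd
      obtain ⟨l, hl, hd⟩ := hd.exists_conj_union
      have hls : (conj l).IsSentence := isSentence_conj fun ψ hψ => (hl ψ hψ).2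
      have hlK : ((conj l).imp β).consts ⊆ K := by
        refine Set.union_subset (fun c hc => ?_) (hB β hβ).2
        obtain ⟨ψ, hψ, hc⟩ := Ded.consts_conj hc
        exact (hX ψ (hl ψ hψ).1).2 hc
      have hd := hd.imp_intro hls
      -- If `X` and the necessary sentences implied β, the universal closure θ of the implication
      -- from `X` to β would be necessary at the end of `p`, against `hav`.
      obtain ⟨θ, h₁, h₂, h₃, h₄⟩ := Ded.exists_allClosure (Ax := Ax) (lang tag p) hd.isSentence
      have hθ := Ded.box_intro (h₄ _ (fun θ hθ => (hT.inLang _ hθ).2) hd)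
      have hθL : InLang (lang tag p ∩ K) θ := ⟨h₁, fun c hc => ⟨(h₂ hc).1, hlK (h₂ hc).2⟩⟩
      refine hav θ hθL ⟨β, hβ, ?_⟩
        (hT.closed _ ⟨h₁, hθL.2.trans Set.inter_subset_left⟩ hθ)
      refine .mp (h₃.mono (by simp)) (Ded.conj_intro fun ψ hψ => ?_)
      exact .hyp (.inr (hl ψ hψ).1) (hl ψ hψ).2)
  rw [← lang_succ k ∅ T p] at hT' hmaxT
  refine ⟨T, ⟨hT', hp, fun _ => ⟨fun φ hφ => hXT (.inr hφ), fun α hα hc => ?_⟩⟩,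
    Set.subset_union_left.trans hXT, hBT, hmaxT⟩
  -- The ◇ half of the link: were ◇α missing below, maximality would yield ◇α → □θ there, hence □(α
  -- → θ) by `fs1`, so that θ and then a member of `B` would follow in `T`.
  by_contra h
  have hαs := (hT'.inLang α hα).1
  obtain ⟨θ, hθ, ⟨β, hβ, hd⟩, hd'⟩ := hmax α.dia ⟨hαs, hc⟩ h
  have hd'' := Ded.box_imp (hd'.imp_intro hαs)
  have : α.imp θ ∈ T := hXT (.inr (hT.closed _ ⟨hd''.isSentence,
    Set.union_subset hc (hθ.2.trans Set.inter_subset_left)⟩ hd''))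
  have hθT : Ded Ax T θ := .mp (.hyp this (isSentence_imp.2 ⟨hαs, hθ.1⟩)) (.hyp hα hαs)
  exact hBT β hβ ((hd.mono (Set.insert_subset_insert (Set.subset_union_left.trans hXT))).cut_insert
    hθT)

/-- A path can be extended so that its last theory contains `A` and is maximal among those that
imply no member of `B`, if the present last theory together with `A` implies no member of `B`. -/
theorem exists_maximal_extension (htag : ∀ p, {c | tag c = some p}.Infinite) (a : Layer σ)
    (p : List (Layer σ)) (hp : IsPath Ax tag (a :: p)) {A B : Set (Formula σ)}
    (hA : ∀ φ ∈ A, InLang (lang tag ((a.1 + 1, ∅) :: p)) φ)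
    (hB : ∀ φ ∈ B, InLang (lang tag ((a.1 + 1, ∅) :: p)) φ) (hdir : IsDirected Ax B)
    (hav : ∀ β ∈ B, ¬ Ded Ax (a.2 ∪ A) β) :
    ∃ a' p', IsPath Ax tag (a' :: p') ∧ PathLE ((a.1 + 1, a.2) :: p) (a' :: p') ∧ A ⊆ a'.2 ∧
      (∀ β ∈ B, ¬ Ded Ax a'.2 β) ∧
      ∀ χ, InLang (lang tag (a' :: p')) χ → χ ∉ a'.2 → ∃ β ∈ B, Ded Ax (insert χ a'.2) β := by
  have hsub : lang tag (a :: p) ⊆ lang tag ((a.1 + 1, ∅) :: p) := by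
    rw [lang_succ a.1 a.2 ∅ p]; exact Set.subset_union_left
  have hX : ∀ φ ∈ a.2 ∪ A, InLang (lang tag ((a.1 + 1, ∅) :: p)) φ := by
    rintro φ (h | h)
    exacts [(hp.1.inLang φ h).mono hsub, hA φ h]
  induction p generalizing a A B with
  | nil =>
    -- The constants of level `a.1` may occur in `A` and `B`, so the witnesses come from level `a.1
    -- + 1`. This is why the level rises by two.
    obtain ⟨T, hT, hXT, hBT, hmax⟩ := exists_theory (Ax := Ax) (htag (0, a.1 + 1))
      (disjoint_lang (a.1 + 1) ∅ []) hX hB hdir hav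
    have := lang_succ (tag := tag) (a.1 + 1) ∅ T []
    simp only [List.length_nil] at this
    rw [← this] at hT hmax
    exact ⟨(a.1 + 1 + 1, T), [], ⟨hT, trivial, fun h => (h rfl).elim⟩,
      .cons ⟨by simp, Set.subset_union_left.trans hXT⟩ .nil,
      Set.subset_union_right.trans hXT, hBT, hmax⟩
  | cons b q ih =>
    have hlink := hp.2.2 (by simp)
    -- The sentences that the new last theory must not contain. Their necessitations are what the
    -- preceding theory has to avoid, and a disjunction of two of them is again one, which makes the
    -- boxed set directed.
    let Θ : Set (Formula σ) :=
      {θ | InLang (lang tag (b :: q)) θ ∧ ∃ β ∈ B, Ded Ax (insert θ (a.2 ∪ A)) β}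
    have hsubq : lang tag (b :: q) ⊆ lang tag ((b.1 + 1, ∅) :: q) := by
      rw [lang_succ b.1 b.2 ∅ q]; exact Set.subset_union_left
    have hΘdir : IsDirected Ax (Formula.box '' Θ) := by
      refine ⟨?_, ?_⟩
      · obtain ⟨β, hβ⟩ := hdir.nonempty
        exact ⟨_, .bot, ⟨⟨rfl, Set.empty_subset _⟩, β, hβ,
          Ded.exfalso (Ded.hyp_insert rfl) (hB β hβ).1⟩, rfl⟩
      · rintro _ ⟨θ₁, ⟨h₁, β₁, hβ₁, d₁⟩, rfl⟩ _ ⟨θ₂, ⟨h₂, β₂, hβ₂, d₂⟩, rfl⟩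
        obtain ⟨β, hβ, e₁, e₂⟩ := hdir.directed β₁ hβ₁ β₂ hβ₂
        have hs : (θ₁.or θ₂).IsSentence := isSentence_or.2 ⟨h₁.1, h₂.1⟩
        refine ⟨_, ⟨θ₁.or θ₂, ⟨⟨hs, Set.union_subset h₁.2 h₂.2⟩, β, hβ, ?_⟩, rfl⟩, ?_, ?_⟩
        · refine Ded.or_elim (Ded.hyp_insert hs) (e₁.cut ?_) (e₂.cut ?_)
          · rintro _ rfl _
            exact d₁.mono (Set.insert_subset_insert (Set.subset_insert _ _))
          · rintro _ rfl _
            exact d₂.mono (Set.insert_subset_insert (Set.subset_insert _ _))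
        · exact Ded.box_mono (Ded.or_left (.hyp rfl h₁.1) h₂.1) (.hyp rfl h₁.1)
        · exact Ded.box_mono (Ded.or_right (.hyp rfl h₂.1) h₁.1) (.hyp rfl h₂.1)
    -- The induction hypothesis applies because □θ in `b.2` would put θ in `a.2`, and `a.2 ∪ A`
    -- would then imply a member of `B`.
    obtain ⟨b', q', hq', hle', -, hav', hmax'⟩ := ih b hp.2.1 (A := ∅) (B := Formula.box '' Θ)
      (by simp)
      (by rintro _ ⟨θ, ⟨hθ, -⟩, rfl⟩; exact ⟨hθ.1, hθ.2.trans hsubq⟩) hΘdir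
      (by
        rintro _ ⟨θ, ⟨hθ, β, hβ, hd⟩, rfl⟩ h
        rw [Set.union_empty] at h
        have hθT := hlink.box θ (hp.2.1.1.closed _ ⟨hθ.1, hθ.2⟩ h)
        rw [Set.insert_eq_of_mem (.inl hθT)] at hd
        exact hav β hβ hd)
      hsubq (by
        rintro φ (h | h)
        exacts [(hp.2.1.1.inLang φ h).mono hsubq, h.elim])
    have hle := hle'.of_succ
    have hcap : lang tag (b' :: q') ∩ lang tag ((a.1 + 1, ∅) :: b :: q) = lang tag (b :: q) :=
      lang_inter_lang_cons hle _
    obtain ⟨T, hT, hXT, hBT, hmax⟩ := exists_layer_avoiding (B := B) htag hq' (by simp) (a.1 + 1)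
      (PathLE.lang_subset (.cons le_rfl hle)) hX hB hdir
      (by
        intro θ hθ hd h
        rw [hcap] at hθ
        exact hav' _ ⟨θ, ⟨hθ, hd⟩, rfl⟩ (.hyp h hθ.1))
      (by
        intro χ hχ h
        obtain ⟨_, ⟨θ, ⟨hθ, hd⟩, rfl⟩, hd'⟩ := hmax' χ hχ h
        exact ⟨θ, by rwa [hcap], hd, hd'⟩)
    exact ⟨_, _, hT, .cons ⟨by simp, Set.subset_union_left.trans hXT⟩ hle,
      Set.subset_union_right.trans hXT, hBT, hmax⟩

end FOFS

namespace FOFS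

variable {σ : Signature} {Ax : Set (Formula σ)}

/-! ### The canonical frame -/

open Formula

theorem PathLE.refl (p : List (Layer σ)) : PathLE p p := by
  induction p with
  | nil => exact .nil
  | cons a p ih => exact .cons le_rfl ih

theorem PathLE.trans {p q r : List (Layer σ)} (h : PathLE p q) (h' : PathLE q r) :
    PathLE p r := by
  induction h generalizing r with
  | nil => exact h'
  | cons hab _ ih =>
    cases h' with
    | cons hbc hqr => exact .cons (hab.trans hbc) (ih hqr)

theorem PathLE.antisymm {p q : List (Layer σ)} (h : PathLE p q) (h' : PathLE q p) : p = q := by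
  induction h with
  | nil => rfl
  | cons hab _ ih =>
    cases h' with
    | cons hba hqp => rw [le_antisymm hab hba, ih hqp]

theorem PathLE.exists_eq_append {l p q : List (Layer σ)} (h : PathLE (l ++ p) q) :
    ∃ l' q', q = l' ++ q' ∧ l'.length = l.length ∧ PathLE p q' := by
  induction l generalizing q with
  | nil => exact ⟨[], q, rfl, rfl, h⟩
  | cons a l ih =>
    cases h with
    | cons _ h =>
      obtain ⟨l', q', rfl, hl, hle⟩ := ih h
      exact ⟨_ :: l', q', rfl, by simp [hl], hle⟩

/-- The identity axiom exchanges a single constant, so the arguments are replaced one position at a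
time. -/
theorem Ded.pred_congr {X : Set (Formula σ)} {P : σ.Pred} {a b : Fin (σ.arity P) → σ.Const}
    (hab : ∀ i, Ded Ax X (.eq (.const (a i)) (.const (b i))))
    (h : Ded Ax X (.pred P fun i => .const (a i))) : Ded Ax X (.pred P fun i => .const (b i)) := by
  classical
  have key : ∀ s : Finset (Fin (σ.arity P)),
      Ded Ax X (.pred P fun i => .const (if i ∈ s then b i else a i)) := by
    intro s
    induction s using Finset.induction_on with
    | empty => simpa using h
    | @insert j s hj ih =>
      let φ : Formula σ := .pred P fun i =>
        if i = j then .var 0 else .const (if i ∈ s then b i else a i)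
      have hφ : φ.FreeOnly 0 := by
        refine Set.iUnion_subset fun i => ?_
        by_cases hi : i = j <;> simp [hi, Term.vars]
      have hsub (d : σ.Const) : φ.subst 0 d = .pred P fun i =>
          if i = j then .const d else .const (if i ∈ s then b i else a i) := by
        simp only [φ, subst, pred.injEq, heq_eq_eq, true_and]
        funext i
        by_cases hi : i = j <;> simp [hi, Term.subst]
      have := eq_subst hφ trivial (hab j) (c := a j) (d := b j)
      rw [hsub, hsub] at this
      convert this ?_ using 2
      · funext i
        by_cases hi : i = j <;> simp [hi]
      · convert ih using 2
        funext i
        by_cases hi : i = j <;> simp [hi, hj]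
  simpa using key Finset.univ

theorem Ded.map (hAx : ∀ f, ∀ φ ∈ Ax, φ.map f ∈ Ax) {X : Set (Formula σ)} {φ : Formula σ}
    (h : Ded Ax X φ) (f : σ.Const → σ.Const) : Ded Ax (Formula.map f '' X) (φ.map f) := by
  induction h with
  | hyp h hs => exact .hyp ⟨_, h, rfl⟩ (isSentence_map.2 hs)
  | thm h hs => exact .thm (h.map hAx f) (isSentence_map.2 hs)
  | mp _ _ ih₁ ih₂ => exact .mp ih₁ ih₂

variable (Ax) in
/-- The frame of nonempty paths of theories; a path accesses its proper prolongations. -/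
def canonicalFrame {tag : σ.Const → Option (ℕ × ℕ)}
    (htag : ∀ p, {c | tag c = some p}.Infinite) : Frame.{u, v} where
  World := ULift.{u} {p : List (Layer σ) // IsPath Ax tag p ∧ p ≠ []}
  order :=
    { le := fun w w' => PathLE w.down.1 w'.down.1
      lt := fun w w' => PathLE w.down.1 w'.down.1 ∧ ¬ PathLE w'.down.1 w.down.1
      lt_iff_le_not_ge := fun _ _ => Iff.rfl
      le_refl := fun w => PathLE.refl _
      le_trans := fun _ _ _ => PathLE.trans
      le_antisymm := fun _ _ h h' => ULift.ext _ _ (Subtype.ext (h.antisymm h')) }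
  M w v := ∃ l, l ≠ [] ∧ v.down.1 = l ++ w.down.1
  fc1 := by
    rintro ⟨w, hw⟩ ⟨v, hv⟩ ⟨v', hv'⟩ ⟨l, hl, h⟩ hle
    obtain rfl : v = l ++ w := h
    -- The required world is the initial part of v' that is as long as w.
    obtain ⟨l', w', rfl, hl', hle'⟩ := PathLE.exists_eq_append (show PathLE (l ++ w) v' from hle)
    refine ⟨⟨w', hv'.1.of_append, ?_⟩, hle', l', ?_, rfl⟩
    · rintro rfl; cases hle'; exact hw.2 rfl
    · rintro rfl; exact hl (List.length_eq_zero_iff.1 hl'.symm)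
  fc2 := by
    rintro ⟨w, hw⟩ ⟨w', hw'⟩ ⟨v, hv⟩ ⟨l, hl, h⟩ hle
    obtain rfl : v = l ++ w := h
    obtain ⟨l', hl', hp, hle'⟩ := exists_append_extension htag hw.2 hv.1 hw'.1 hle
    refine ⟨⟨l' ++ w', hp, by simp [hw'.2]⟩, hle', l', ?_, rfl⟩
    rintro rfl; exact hl (List.length_eq_zero_iff.1 hl'.symm)
  Obj := ULift.{v} σ.Const
  D w := {a | a.down ∈ lang tag w.down.1}
  D_le w w' h a ha := PathLE.lang_subset h ha
  D_M := by
    rintro ⟨w, hw⟩ ⟨v, hv⟩ ⟨l, hl, h⟩ a ha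
    obtain rfl : v = l ++ w := h
    exact lang_subset_append l w ha
  E w a b := .eq (.const a.down) (.const b.down) ∈ top w.down.1
  E_mem w a b h := by
    have := ((w.down.2.1.isTheory w.down.2.2).inLang _ h).2
    exact ⟨this (.inl rfl), this (.inr rfl)⟩
  E_refl w a ha := by
    have h := Ded.eq_refl (Ax := Ax) (X := top w.down.1) a.down
    refine (w.down.2.1.isTheory w.down.2.2).closed _ ⟨h.isSentence, ?_⟩ h
    exact Set.union_subset (Set.singleton_subset_iff.2 ha) (Set.singleton_subset_iff.2 ha)
  E_symm w a b h := by
    have hT := w.down.2.1.isTheory w.down.2.2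
    have hL := hT.inLang _ h
    have h' := Ded.eq_symm (Ax := Ax) (.hyp h hL.1)
    exact hT.closed _ ⟨h'.isSentence, Set.union_subset (fun c hc => hL.2 (.inr hc))
      (fun c hc => hL.2 (.inl hc))⟩ h'
  E_trans w a b c h₁ h₂ := by
    have hT := w.down.2.1.isTheory w.down.2.2
    have hL₁ := hT.inLang _ h₁
    have hL₂ := hT.inLang _ h₂
    have h' := Ded.eq_trans (Ax := Ax) (.hyp h₁ hL₁.1) (.hyp h₂ hL₂.1)
    exact hT.closed _ ⟨h'.isSentence, Set.union_subset (fun c hc => hL₁.2 (.inl hc))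
      (fun c hc => hL₂.2 (.inr hc))⟩ h'
  E_le w w' a b h hab := PathLE.top_subset h hab

/-! ### Frame conditions and the truth lemma -/

section Truth

variable {tag : σ.Const → Option (ℕ × ℕ)} (htag : ∀ p, {c | tag c = some p}.Infinite)
  {ι : σ.Const → σ.Const} (hι : ∀ c, tag (ι c) = none)

theorem canonicalFrame_mem_transitiveFrames :
    canonicalFrame Ax htag ∈ transitiveFrames.{u, v} := by
  rintro ⟨w, hw⟩ ⟨v, hv⟩ ⟨t, ht⟩ ⟨l, hl, h⟩ ⟨l', hl', h'⟩
  obtain rfl : v = l ++ w := h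
  obtain rfl : t = l' ++ (l ++ w) := h'
  exact ⟨l' ++ l, by simp [hl], by simp⟩

theorem canonicalFrame_mem_serialFrames (hD : axD σ ⊆ Ax) :
    canonicalFrame Ax htag ∈ serialFrames.{u, v} := by
  rintro ⟨w, hw⟩
  have hT := hw.1.isTheory hw.2
  have hc : ∀ φ ∈ ({Formula.top} : Set (Formula σ)), InLang (lang tag w) φ := by
    rintro _ rfl
    exact ⟨by simp, by simp [Formula.top, neg, consts]⟩
  -- D turns □⊤ into ◇⊤, so every consequence of ⊤ is possible.
  obtain ⟨T, hT', -⟩ := exists_layer_of_dia htag hw.1 hw.2 0 (lang_subset_cons _ w) hc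
    fun γ hγ hd => hT.closed _ ⟨hγ.1, hγ.2.trans Set.inter_subset_left⟩ (Ded.dia_mono hd
      (.mp (.thm (.extra (hD ⟨_, isSentence_top, rfl⟩)) (by simp)) (.thm .box_top (by simp))))
  exact ⟨⟨_, hT', by simp⟩, [(0 + 1, T)], by simp, rfl⟩

variable (Ax) in
/-- The canonical interpretation: each constant `c` denotes `ι c`. -/
def canonicalInterp : Interp σ (canonicalFrame.{u, v} Ax htag) where
  const c := ⟨ι c⟩
  const_mem c w := base_subset_lang w.down.1 (hι c)
  pred w P := {a | .pred P (fun i => .const (a i).down) ∈ top w.down.1}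
  pred_mem w P a ha i := by
    have ha : Formula.pred P (fun i => .const (a i).down) ∈ top w.down.1 := ha
    exact ((w.down.2.1.isTheory w.down.2.2).inLang _ ha).2
      (Set.mem_iUnion.2 ⟨i, Set.mem_singleton _⟩)
  pred_le w w' P h a ha := PathLE.top_subset h ha
  pred_E w P a b hab ha := by
    have hT := w.down.2.1.isTheory w.down.2.2
    have h := Ded.pred_congr (Ax := Ax) (fun i => .hyp (hab i) (hT.inLang _ (hab i)).1)
      (.hyp ha (hT.inLang _ ha).1)
    refine hT.closed _ ⟨h.isSentence, Set.iUnion_subset fun i => ?_⟩ h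
    exact fun c hc => (hT.inLang _ (hab i)).2 (.inr hc)

/-- The sentence obtained from `φ` by renaming its constants along `ι` and replacing its free
variables by their values under `g`. -/
def evalSentence (ι : σ.Const → σ.Const) (g : ℕ → ULift.{v} σ.Const) (φ : Formula σ) :
    Formula σ :=
  (φ.map ι).close fun x => some (g x).down

theorem inLang_evalSentence (hι : ∀ c, tag (ι c) = none) {p : List (Layer σ)}
    {g : ℕ → ULift.{v} σ.Const} (hg : ∀ x, (g x).down ∈ lang tag p) (φ : Formula σ) :
    InLang (lang tag p) (evalSentence ι g φ) := by
  refine ⟨?_, (consts_close _ _).trans (Set.union_subset ?_ ?_)⟩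
  · simp [evalSentence, IsSentence, freeVars_close]
  · rw [consts_map]
    rintro _ ⟨c, -, rfl⟩
    exact base_subset_lang p (hι c)
  · rintro c ⟨x, hx⟩
    cases hx
    exact hg x

theorem update_mem {K : Set σ.Const} {g : ℕ → ULift.{v} σ.Const} (hg : ∀ y, (g y).down ∈ K)
    (x : ℕ) {a : ULift.{v} σ.Const} (ha : a.down ∈ K) (y : ℕ) :
    (Function.update g x a y).down ∈ K := by
  by_cases hy : y = x
  · subst hy; simpa using ha
  · simpa [hy] using hg y

theorem evalSentence_update (g : ℕ → ULift.{v} σ.Const) (φ : Formula σ) (x : ℕ)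
    (c : ULift.{v} σ.Const) :
    ((φ.map ι).close (Function.update (fun x => some (g x).down) x none)).subst x c.down =
      evalSentence ι (Function.update g x c) φ := by
  rw [subst_close _ (by simp), Function.update_idem, evalSentence]
  congr 1
  funext y
  by_cases hy : y = x
  · subst hy; simp
  · simp [hy]

theorem evalSentence_of_isSentence {φ : Formula σ} (hφ : φ.IsSentence)
    (g : ℕ → ULift.{v} σ.Const) : evalSentence ι g φ = φ.map ι := by
  have h := close_congr (φ := φ.map ι) (ρ := fun x => some (g x).down) (ρ' := fun _ => none)
    fun x hx => by rw [freeVars_map, hφ] at hx; exact hx.elim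
  rw [evalSentence, h, close_none]

theorem const_den (g : ℕ → ULift.{v} σ.Const) (t : Term σ) :
    (t.map ι).close (fun x => some (g x).down) =
      .const ((canonicalInterp.{u, v} Ax htag hι).den g t).down := by
  cases t <;> rfl

/-- For ◇ it is enough to prolong the path; refuting →, □ or ∀ requires enlarging it first. Links
over several layers, hence the axioms 4, enter where □ is used and where ◇ is verified. -/
theorem sat_canonicalInterp (h₄ : axFOFS4 σ ⊆ Ax) (φ : Formula σ)
    (w : (canonicalFrame.{u, v} Ax htag).World) (g : ℕ → ULift.{v} σ.Const)
    (hg : ∀ x, (g x).down ∈ lang tag w.down.1) :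
    (canonicalInterp Ax htag hι).Sat φ w g ↔ evalSentence ι g φ ∈ top w.down.1 := by
  induction φ generalizing w g with
  | pred P t =>
    have : evalSentence ι g (.pred P t) =
        .pred P fun i => .const ((canonicalInterp.{u, v} Ax htag hι).den g (t i)).down :=
      congrArg (Formula.pred P) (funext fun i => const_den htag hι g (t i))
    rw [this]
    exact Iff.rfl
  | eq s t =>
    have : evalSentence ι g (.eq s t) =
        .eq (.const ((canonicalInterp.{u, v} Ax htag hι).den g s).down)
          (.const ((canonicalInterp.{u, v} Ax htag hι).den g t).down) :=
      congrArg₂ Formula.eq (const_den htag hι g s) (const_den htag hι g t)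
    rw [this]
    exact Iff.rfl
  | bot =>
    have hT := w.down.2.1.isTheory w.down.2.2
    exact ⟨False.elim, fun h => hT.bot h⟩
  | and φ ψ ih₁ ih₂ =>
    have hT := w.down.2.1.isTheory w.down.2.2
    have hL := inLang_evalSentence hι hg
    refine (and_congr (ih₁ w g hg) (ih₂ w g hg)).trans ⟨fun h => ?_, fun h => ⟨?_, ?_⟩⟩
    · exact hT.closed _ (hL (.and φ ψ)) (Ded.and_intro (.hyp h.1 (hL φ).1) (.hyp h.2 (hL ψ).1))
    · exact hT.closed _ (hL φ) (Ded.and_left (.hyp h (hL (.and φ ψ)).1))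
    · exact hT.closed _ (hL ψ) (Ded.and_right (.hyp h (hL (.and φ ψ)).1))
  | or φ ψ ih₁ ih₂ =>
    have hT := w.down.2.1.isTheory w.down.2.2
    have hL := inLang_evalSentence hι hg
    refine (or_congr (ih₁ w g hg) (ih₂ w g hg)).trans ⟨fun h => ?_, hT.prime _ _⟩
    refine hT.closed _ (hL (.or φ ψ)) (h.elim (fun h => ?_) (fun h => ?_))
    · exact Ded.or_left (.hyp h (hL φ).1) (hL ψ).1
    · exact Ded.or_right (.hyp h (hL ψ).1) (hL φ).1
  | imp φ ψ ih₁ ih₂ =>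
    have hL := inLang_evalSentence hι hg
    refine ⟨fun h => ?_, fun h w' hw hφ => ?_⟩
    · by_contra hn
      obtain ⟨⟨p, hp, hne⟩⟩ := w
      obtain ⟨a, p, rfl⟩ := List.exists_cons_of_ne_nil hne
      have hsub : lang tag (a :: p) ⊆ lang tag ((a.1 + 1, ∅) :: p) :=
        PathLE.lang_subset (p := (a.1, ∅) :: p) (.cons ⟨Nat.le_succ _, le_rfl⟩ (PathLE.refl p))
      obtain ⟨a', p', hp', hle', hA, hB, -⟩ := exists_maximal_extension htag a p hp
        (A := {evalSentence ι g φ}) (B := {evalSentence ι g ψ})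
        (by rintro _ rfl; exact (hL φ).mono hsub) (by rintro _ rfl; exact (hL ψ).mono hsub)
        (isDirected_singleton (hL ψ).1) (by
          rintro _ rfl hd
          rw [Set.union_singleton] at hd
          exact hn (hp.1.closed _ (hL (.imp φ ψ)) (hd.imp_intro (hL φ).1)))
      have hle := hle'.of_succ
      have hg' : ∀ x, (g x).down ∈ lang tag (a' :: p') := fun x => hle.lang_subset (hg x)
      have hψ := (ih₂ ⟨a' :: p', hp', by simp⟩ g hg').1
        (h ⟨a' :: p', hp', by simp⟩ hle ((ih₁ ⟨a' :: p', hp', by simp⟩ g hg').2 (hA rfl)))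
      exact hB _ rfl (.hyp hψ (hL ψ).1)
    · have hg' : ∀ x, (g x).down ∈ lang tag w'.down.1 := fun x => PathLE.lang_subset hw (hg x)
      have hT := w'.down.2.1.isTheory w'.down.2.2
      refine (ih₂ w' g hg').2 (hT.closed _ (inLang_evalSentence hι hg' ψ) ?_)
      exact .mp (.hyp (PathLE.top_subset hw h) (hL (.imp φ ψ)).1)
        (.hyp ((ih₁ w' g hg').1 hφ) (hL φ).1)
  | box φ ih =>
    have hL := inLang_evalSentence hι hg
    refine ⟨fun h => ?_, ?_⟩
    · by_contra hn
      obtain ⟨⟨p, hp, hne⟩⟩ := w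
      obtain ⟨a, p, rfl⟩ := List.exists_cons_of_ne_nil hne
      have hsub : lang tag (a :: p) ⊆ lang tag ((a.1 + 1, ∅) :: p) :=
        PathLE.lang_subset (p := (a.1, ∅) :: p) (.cons ⟨Nat.le_succ _, le_rfl⟩ (PathLE.refl p))
      -- □φ is refuted in two moves: the path is enlarged until its last theory is maximal without
      -- □φ, and only this maximality allows a further layer that omits φ.
      obtain ⟨a', p', hp', hle', -, hB, hmax⟩ := exists_maximal_extension htag a p hp
        (A := ∅) (B := {(evalSentence ι g φ).box}) (by simp)
        (by rintro _ rfl; exact (hL (.box φ)).mono hsub)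
        (isDirected_singleton (hL (.box φ)).1) (by
          rintro _ rfl hd
          rw [Set.union_empty] at hd
          exact hn (hp.1.closed _ (hL (.box φ)) hd))
      have hle := hle'.of_succ
      have hL' : InLang (lang tag (a' :: p')) (evalSentence ι g φ) :=
        (hL φ).mono hle.lang_subset
      obtain ⟨T, hT, -, hBT, -⟩ := exists_layer_avoiding htag hp' (by simp) 0
        (lang_subset_cons _ (a' :: p')) (X := ∅) (B := {evalSentence ι g φ}) (by simp)
        (by rintro _ rfl; exact hL') (isDirected_singleton (hL φ).1)
        (by
          rintro θ hθ ⟨_, rfl, hd⟩ h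
          exact hB _ rfl (Ded.box_mono (by simpa using hd) (.hyp h hθ.1)))
        (by
          intro χ hχ h
          obtain ⟨_, rfl, hd⟩ := hmax χ hχ h
          exact ⟨_, by rwa [Set.inter_self], ⟨_, rfl, Ded.hyp_insert (hL φ).1⟩, hd⟩)
      have hφ := (ih ⟨_, hT, by simp⟩ g fun x =>
        lang_subset_cons _ _ (hle.lang_subset (hg x))).1
        (h ⟨a' :: p', hp', by simp⟩ ⟨_, hT, by simp⟩ hle ⟨[_], by simp, rfl⟩)
      exact hBT _ rfl (.hyp hφ (hL φ).1)
    · rintro h w' ⟨v, hv⟩ hw ⟨l, hl, hv'⟩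
      obtain rfl : v = l ++ w'.down.1 := hv'
      have hlink := hv.1.link h₄ hl w'.down.2.2
      exact (ih ⟨_, hv⟩ g fun x => lang_subset_append _ _ (PathLE.lang_subset hw (hg x))).2
        (hlink.box _ (PathLE.top_subset hw h))
  | dia φ ih =>
    have hL := inLang_evalSentence hι hg
    have hT := w.down.2.1.isTheory w.down.2.2
    refine ⟨?_, fun h => ?_⟩
    · rintro ⟨⟨v, hv⟩, ⟨l, hl, hv'⟩, h⟩
      obtain rfl : v = l ++ w.down.1 := hv'
      have hlink := hv.1.link h₄ hl w.down.2.2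
      exact hlink.dia _ ((ih ⟨_, hv⟩ g fun x => lang_subset_append _ _ (hg x)).1 h) (hL φ).2
    · obtain ⟨T, hp, hsub⟩ := exists_layer_of_dia htag w.down.2.1 w.down.2.2 0
        (lang_subset_cons _ _) (X := {evalSentence ι g φ}) (by rintro _ rfl; exact hL φ)
        fun γ hγ hd => hT.closed _ ⟨hγ.1, hγ.2.trans Set.inter_subset_left⟩
          (Ded.dia_mono hd (.hyp h (hL (.dia φ)).1))
      exact ⟨⟨_, hp, by simp⟩, ⟨[_], by simp, rfl⟩,
        (ih ⟨_, hp, by simp⟩ g fun x => lang_subset_cons _ _ (hg x)).2 (hsub rfl)⟩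
  | all x φ ih =>
    have hL := inLang_evalSentence hι hg
    have hφ := isSentence_all.1 (hL (.all x φ)).1
    refine ⟨fun h => ?_, fun h w' hw (a : ULift.{v} σ.Const)
      (ha : a.down ∈ lang tag w'.down.1) => ?_⟩
    · by_contra hn
      obtain ⟨⟨p, hp, hne⟩⟩ := w
      obtain ⟨a, p, rfl⟩ := List.exists_cons_of_ne_nil hne
      have hsub : lang tag (a :: p) ⊆ lang tag ((a.1 + 1, ∅) :: p) :=
        PathLE.lang_subset (p := (a.1, ∅) :: p) (.cons ⟨Nat.le_succ _, le_rfl⟩ (PathLE.refl p))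
      -- The counterexample is a constant of the first unused level of the last layer: new to the
      -- path, yet available once the level has been raised by one.
      obtain ⟨c, hc⟩ := (htag (p.length, a.1)).nonempty
      have hfresh : c ∉ lang tag (a :: p) := fun h =>
        (disjoint_lang a.1 a.2 p).le_bot ⟨h, hc⟩
      have hcL : c ∈ lang tag ((a.1 + 1, ∅) :: p) := .inr ⟨a.1, Nat.lt_succ_self _, hc⟩
      have hgc := update_mem (fun y => hsub (hg y)) x (a := ⟨c⟩) hcL
      have hLc := inLang_evalSentence hι hgc φ
      obtain ⟨a', p', hp', hle', -, hB, -⟩ := exists_maximal_extension htag a p hp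
        (A := ∅) (B := {evalSentence ι (Function.update g x ⟨c⟩) φ}) (by simp)
        (by rintro _ rfl; exact hLc) (isDirected_singleton hLc.1) (by
          rintro _ rfl hd
          rw [Set.union_empty, ← evalSentence_update] at hd
          refine hn (hp.1.closed _ (hL (.all x φ)) (Ded.all_intro (c := c) hφ ?_ ?_ hd))
          · exact fun h => hfresh ((hL (.all x φ)).2 h)
          · exact fun ψ hψ h => hfresh ((hp.1.inLang ψ hψ).2 h))
      have hle := hle'.of_succ
      have hcL' : c ∈ lang tag (a' :: p') := hle'.lang_subset (.inr ⟨a.1, Nat.lt_succ_self _, hc⟩)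
      have hgc' := update_mem (fun y => hle.lang_subset (hg y)) x (a := ⟨c⟩) hcL'
      have hφ' := (ih ⟨a' :: p', hp', by simp⟩ _ hgc').1
        (h ⟨a' :: p', hp', by simp⟩ hle ⟨c⟩ hcL')
      exact hB _ rfl (.hyp hφ' hLc.1)
    · have hg' := update_mem (fun y => PathLE.lang_subset hw (hg y)) x ha
      have hT := w'.down.2.1.isTheory w'.down.2.2
      refine (ih w' _ hg').2 (hT.closed _ (inLang_evalSentence hι hg' φ) ?_)
      rw [← evalSentence_update]
      exact Ded.all_elim (.hyp (PathLE.top_subset hw h) (hL (.all x φ)).1) _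
  | ex x φ ih =>
    have hL := inLang_evalSentence hι hg
    have hT := w.down.2.1.isTheory w.down.2.2
    have hφ := isSentence_ex.1 (hL (.ex x φ)).1
    have hg' (a : ULift.{v} σ.Const) (ha : a.down ∈ lang tag w.down.1) := update_mem hg x ha
    refine ⟨fun ⟨(a : ULift.{v} σ.Const), ha, h⟩ => ?_, fun h => ?_⟩
    · have h' := (ih w _ (hg' a ha)).1 h
      refine hT.closed _ (hL (.ex x φ)) (Ded.ex_intro hφ (c := a.down) ?_)
      rw [evalSentence_update]
      exact .hyp h' (inLang_evalSentence hι (hg' a ha) φ).1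
    · obtain ⟨c, hc, h⟩ := hT.witness _ _ h
      refine ⟨⟨c⟩, hc, (ih w _ (hg' ⟨c⟩ hc)).2 ?_⟩
      rwa [← evalSentence_update]

end Truth

/-! ### Renaming constants and the completeness theorem -/

/-- The constants split into infinitely many infinite parts, one of which is a copy of all of
them. -/
theorem exists_tag (σ : Signature) : ∃ (tag : σ.Const → Option (ℕ × ℕ)) (ι κ : σ.Const → σ.Const),
    (∀ p, {c | tag c = some p}.Infinite) ∧ (∀ c, tag (ι c) = none) ∧ ∀ c, κ (ι c) = c := by
  have := σ.countable_const
  have := σ.infinite_const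
  obtain ⟨e⟩ := nonempty_equiv_of_countable (α := σ.Const) (β := σ.Const ⊕ (ℕ × ℕ) × ℕ)
  refine ⟨fun c => (e c).elim (fun _ => none) (fun q => some q.1), fun c => e.symm (.inl c),
    fun c => (e c).elim id (fun _ => c), fun p => ?_, by simp, by simp⟩
  refine Set.infinite_of_injective_forall_mem (f := fun n : ℕ => e.symm (.inr (p, n))) ?_ ?_
  · intro m n h
    simpa using h
  · intro n
    show Sum.elim _ _ (e (e.symm _)) = _
    simp

/-- Completeness for each class that contains the canonical frames. -/
theorem Entails.derives (h₄ : axFOFS4 σ ⊆ Ax) (hAx : ∀ f, ∀ φ ∈ Ax, φ.map f ∈ Ax)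
    {C : Set Frame.{u, v}}
    (hC : ∀ (tag : σ.Const → Option (ℕ × ℕ)) (htag : ∀ p, {c | tag c = some p}.Infinite),
      canonicalFrame Ax htag ∈ C)
    {Γ : Set (Formula σ)} {φ : Formula σ} (hΓ : ∀ γ ∈ Γ, γ.IsSentence) (hφ : φ.IsSentence)
    (h : Entails C Γ φ) : Derives Ax Γ φ := by
  obtain ⟨tag, ι, κ, htag, hι, hκ⟩ := exists_tag σ
  by_contra hn
  -- A derivation of the renamed sentence is carried back along the left inverse `κ`, which need not
  -- be injective.
  have hd : ¬ Ded Ax (Formula.map ι '' Γ) (φ.map ι) := by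
    intro hd
    have := hd.map hAx κ
    rw [map_map_of_leftInverse hκ, Set.image_image] at this
    simp only [map_map_of_leftInverse hκ, Set.image_id'] at this
    exact hn this.derives
  have hL (ψ : Formula σ) (hψ : ψ.IsSentence) : InLang (lang tag [(0, ∅)]) (ψ.map ι) := by
    refine ⟨isSentence_map.2 hψ, ?_⟩
    rw [consts_map]
    rintro _ ⟨c, -, rfl⟩
    exact base_subset_lang _ (hι c)
  -- At level 0 the single layer has only the untagged constants, where the renamed sentences live;
  -- its witnesses have tag `(0, 0)`, and the resulting one-layer path has level 1.
  obtain ⟨T, hT, hsub, hB, -⟩ := exists_theory (Ax := Ax) (htag (0, 0)) (disjoint_lang 0 ∅ [])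
    (X := Formula.map ι '' Γ) (B := {φ.map ι})
    (by rintro _ ⟨γ, hγ, rfl⟩; exact hL γ (hΓ γ hγ)) (by rintro _ rfl; exact hL φ hφ)
    (isDirected_singleton (isSentence_map.2 hφ)) (by rintro _ rfl; exact hd)
  have hlang := lang_succ (tag := tag) 0 ∅ T []
  simp only [List.length_nil] at hlang
  rw [← hlang] at hT
  let w : (canonicalFrame.{u, v} Ax htag).World :=
    ⟨[(0 + 1, T)], ⟨hT, trivial, fun h => (h rfl).elim⟩, by simp⟩
  have htruth (ψ : Formula σ) (hψ : ψ.IsSentence) (g : ℕ → ULift.{v} σ.Const)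
      (hg : ∀ x, (g x).down ∈ lang tag w.down.1) :
      (canonicalInterp Ax htag hι).Sat ψ w g ↔ ψ.map ι ∈ T := by
    rw [sat_canonicalInterp htag hι h₄ ψ w g hg, evalSentence_of_isSentence hψ]
    rfl
  obtain ⟨c⟩ : Nonempty σ.Const := σ.infinite_const.nonempty
  have hg : ∀ _ : ℕ, (ULift.up.{v} (ι c)).down ∈ lang tag w.down.1 :=
    fun _ => base_subset_lang _ (hι c)
  have hφT := h _ (hC tag htag) (canonicalInterp Ax htag hι) w
    (fun γ hγ g hg => (htruth γ (hΓ γ hγ) g hg).2 (hsub ⟨γ, hγ, rfl⟩)) (fun _ => ⟨ι c⟩) hg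
  exact hB _ rfl (.hyp ((htruth φ hφ _ hg).1 hφT) (isSentence_map.2 hφ))

theorem map_mem_axFOFS4 (f : σ.Const → σ.Const) {φ : Formula σ} (h : φ ∈ axFOFS4 σ) :
    φ.map f ∈ axFOFS4 σ := by
  rcases h with ⟨φ, hφ, rfl⟩ | ⟨φ, hφ, rfl⟩
  · exact .inl ⟨φ.map f, isSentence_map.2 hφ, rfl⟩
  · exact .inr ⟨φ.map f, isSentence_map.2 hφ, rfl⟩

theorem map_mem_axFOFSD4 (f : σ.Const → σ.Const) {φ : Formula σ} (h : φ ∈ axFOFSD4 σ) :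
    φ.map f ∈ axFOFSD4 σ := by
  rcases h with ⟨φ, hφ, rfl⟩ | h
  · exact .inl ⟨φ.map f, isSentence_map.2 hφ, rfl⟩
  · exact .inr (map_mem_axFOFS4 f h)

end FOFS

theorem mainTheorem6 (σ : FOFS.Signature) (Γ : Set (FOFS.Formula σ)) (φ : FOFS.Formula σ)
    (hΓ : ∀ γ ∈ Γ, γ.IsSentence) (hφ : φ.IsSentence) :
    (FOFS.Entails FOFS.transitiveFrames.{u, v} Γ φ →
      FOFS.Derives (FOFS.axFOFS4 σ) Γ φ) ∧
    (FOFS.Entails (FOFS.serialFrames.{u, v} ∩ FOFS.transitiveFrames.{u, v}) Γ φ ↔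
      FOFS.Derives (FOFS.axFOFSD4 σ) Γ φ) := by
  refine ⟨fun h => h.derives subset_rfl (fun f _ => FOFS.map_mem_axFOFS4 f) ?_ hΓ hφ,
    fun h => h.derives Set.subset_union_right (fun f _ => FOFS.map_mem_axFOFSD4 f) ?_ hΓ hφ,
    FOFS.Derives.entails⟩
  · exact fun tag htag => FOFS.canonicalFrame_mem_transitiveFrames htag
  · exact fun tag htag => ⟨FOFS.canonicalFrame_mem_serialFrames htag Set.subset_union_left,
      FOFS.canonicalFrame_mem_transitiveFrames htag⟩
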